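/- Let $c>0$. There is a constant $C>0$, depending only on $c$, such that the following holds. Let $\mathcal{Y}$ be a finite set of labels with $|\mathcal{Y}|\ge 2$, let $\mathcal{X}$ be a measurable space of inputs, and let $\mathcal{H}=\{F(\,\cdot\,;w)\}_{w\in\mathcal{W}}$ be a family of discriminant functions $F(\,\cdot\,;w):\mathcal{X}\times\mathcal{Y}\to[-c,c]$ indexed by a measurable space $\mathcal{W}$ (with $F$ jointly measurable). For a probability distribution $p$ on $\mathcal{W}$ let $$h_p(x,y)=\int F(x,y;w)\,dp(w)$$ be the averaging predictor, and for a function $h:\mathcal{X}\times\mathcal{Y}\to\mathbb{R}$ let $$M(h,x,y)=h(x,y)-\max_{y'\neq y}h(x,y')$$ be its margin at $(x,y)$. Let $p_0$ be any probability distribution on $\mathcal{W}$ (the prior), let $Q$ be any probability distribution on $\mathcal{X}\times\mathcal{Y}$, let $N\ge 1$ and $\delta\in(0,1)$. Then with probability at least $1-\delta$ over a sample $\mathcal{D}$ of $N$ examples drawn independently from $Q$, for every probability distribution $p$ on $\mathcal{W}$ and every $\gamma>0$ simultaneously, $$\Pr_{Q}\big(M(h_p,x,y)\le 0\big)\;\le\;\Pr_{\mathcal{D}}\big(M(h_p,x,y)\le\gamma\big)+C\sqrt{\frac{\gamma^{-2}\,\mathrm{KL}(p\,\|\,p_0)\,\ln(N|\mathcal{Y}|)+\ln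 N+\ln\delta^{-1}}{N}},$$ where $\Pr_{\mathcal{D}}$ is the empirical frequency over the sample $\mathcal{D}$ and $\mathrm{KL}$ is the Kullback-Leibler divergence (the bound is vacuous when $\mathrm{KL}(p\,\|\,p_0)=\infty$). -/

import Mathlib

open MeasureTheory

namespace MaxEnDNet

/-- The averaging model `h(x, y) = ⟨F(x, y; w)⟩_{w ∼ p}`. -/
noncomputable def averagePredictor {W X Y : Type*} [MeasurableSpace W]
    (p : Measure W) (F : W → X → Y → ℝ) (x : X) (y : Y) : ℝ :=
  ∫ w, F w x y ∂p

/-- The margin `M(h, x, y) = h(x, y) - max_{y' ≠ y} h(x, y')`. The supremum is a maximum whenever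
`Y` is finite and has at least two elements. -/
noncomputable def margin {X Y : Type*} (h : X → Y → ℝ) (x : X) (y : Y) : ℝ :=
  h x y - ⨆ y' : {y' : Y // y' ≠ y}, h x y'

/-- `Pr_Q (M(h, x, y) ≤ γ)`, the probability under the true distribution `Q`. -/
noncomputable def trueMarginError {X Y : Type*} [MeasurableSpace X] [MeasurableSpace Y]
    (Q : Measure (X × Y)) (h : X → Y → ℝ) (γ : ℝ) : ℝ :=
  Q.real {z : X × Y | margin h z.1 z.2 ≤ γ}

open Classical in
/-- `Pr_D (M(h, x, y) ≤ γ)`, the fraction of the `N` sample points whose margin is at most `γ`. -/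
noncomputable def empiricalMarginError {X Y : Type*} {N : ℕ}
    (D : Fin N → X × Y) (h : X → Y → ℝ) (γ : ℝ) : ℝ :=
  ((Finset.univ.filter fun i : Fin N => margin h (D i).1 (D i).2 ≤ γ).card : ℝ) / (N : ℝ)

end MaxEnDNet

/-! Averaging `T` parameters drawn from `p` approximates `h_p`: by Hoeffding, a label's score
difference moves by more than a fixed fraction of `γ` with probability at most `1 / (N |Y|)` once
`T` is of order `c² γ⁻² ln(N |Y|)`. The error of `h_p` at margin 0 is thus compared with its
empirical error at margin `γ` through the sampled predictors at an intermediate threshold. The law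
of the sampled parameters is a product with divergence `T · KL(p ‖ p₀)` from the product prior, so
Donsker–Varadhan (`integral_pi_le_klDiv_add_log`) and a Hoeffding exponential moment under the prior
bound the mean deviation by `(T KL + ln(1/δ) + O(ln N)) / k + k / (8N) + O(1/N)`. Choosing `k` gives
the square root.

The difficulty is uniformity in `γ`: a grid of margins descending to 0 would cost `ln(1/γ)`, which
the bound does not offer. Margins of order at least `c/N` need only `N` resolutions `m`. For smaller
`γ` the bound is nontrivial only if `KL` is at most of order `N γ²`, so `p` is nearly `p₀`. Then
`exists_dilation` replaces `(s + 1) h_p` by `s h_{p₀} + h_{p'}`, where `p'` has density close to `1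
+ (s + 1)(dp/dp₀ - 1)`. The margin becomes `(s + 1) γ`, of order `c/N`, while `KL` grows by at most
`9 (s + 1)²`, so `KL / γ²` is preserved up to a constant.

The integer `s` is unbounded, but for fixed parameters and a fixed example the score differences are
affine in `s`. The `s` at which the margin exceeds the threshold therefore form an interval, and
such a family has `(N + 1)²` lower brackets of precision `2/N`
(`exists_lower_brackets_of_interval`), which costs only `O(ln N)`.

For `N = 1` the term `ln N` vanishes and no union bound is affordable. There `h_p` is uniformly
close to `h_{p₀}` by Pinsker, and a single quantile event for the margin of `h_{p₀}` suffices. -/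

namespace MaxEnDNet

open ProbabilityTheory InformationTheory

/-! ### Change of measure -/

/-- **Donsker–Varadhan inequality** for bounded functions. -/
theorem integral_le_klDiv_add_log {W : Type*} [MeasurableSpace W] (μ ν : Measure W)
    [IsProbabilityMeasure μ] [IsProbabilityMeasure ν] (h : klDiv μ ν ≠ ⊤) {f : W → ℝ}
    (hf : Measurable f) {B : ℝ} (hB : ∀ w, |f w| ≤ B) :
    ∫ w, f w ∂μ ≤ (klDiv μ ν).toReal + Real.log (∫ w, Real.exp (f w) ∂ν) := by
  obtain ⟨hac, hint⟩ := klDiv_ne_top_iff.1 h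
  have hfμ : Integrable f μ :=
    Integrable.of_bound hf.aestronglyMeasurable B (Filter.Eventually.of_forall hB)
  have hfν : Integrable (fun w => Real.exp (f w)) ν := by
    refine Integrable.of_bound hf.exp.aestronglyMeasurable (Real.exp B)
      (Filter.Eventually.of_forall fun w => ?_)
    rw [Real.norm_eq_abs, Real.abs_exp]
    exact Real.exp_le_exp.2 ((le_abs_self _).trans (hB w))
  -- Replacing `ν` by its tilting by `f` changes the divergence from `μ` by `∫ f ∂μ - log ∫ exp f
  -- ∂ν`; nonnegativity of the new divergence is the claim.
  have h1 := integral_llr_tilted_right hac hfμ hfν hint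
  have : IsProbabilityMeasure (ν.tilted f) := isProbabilityMeasure_tilted hfν
  have h2 := integral_llr_add_sub_measure_univ_nonneg
    (hac.trans (absolutelyContinuous_tilted hfν)) (integrable_llr_tilted_right hac hfμ hint hfν)
  rw [toReal_klDiv_of_measure_eq hac (by simp)]
  simp only [probReal_univ] at h2
  linarith

/-- The Donsker–Varadhan inequality for product measures. -/
theorem integral_pi_le_klDiv_add_log {W : Type*} [MeasurableSpace W] (μ ν : Measure W)
    [IsProbabilityMeasure μ] [IsProbabilityMeasure ν] (h : klDiv μ ν ≠ ⊤) (n : ℕ)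
    {f : (Fin n → W) → ℝ} (hf : Measurable f) {B : ℝ} (hB : ∀ w, |f w| ≤ B) :
    ∫ w, f w ∂(Measure.pi fun _ => μ) ≤
      n * (klDiv μ ν).toReal + Real.log (∫ w, Real.exp (f w) ∂(Measure.pi fun _ => ν)) := by
  induction n with
  | zero => simp [integral_unique, measureReal_def]
  | succ n ih =>
    have split (ρ : Measure W) [IsProbabilityMeasure ρ] {g : (Fin (n + 1) → W) → ℝ}
        (hg : Measurable g) {b : ℝ} (hb : ∀ w, |g w| ≤ b) :
        ∫ w, g w ∂(Measure.pi fun _ => ρ) =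
          ∫ x, ∫ y, g (Fin.cons x y) ∂(Measure.pi fun _ => ρ) ∂ρ := by
      have hmp := (measurePreserving_piFinSuccAbove (fun _ : Fin (n + 1) => ρ) 0).symm
      rw [← hmp.integral_comp', integral_prod]
      · simp [MeasurableEquiv.piFinSuccAbove, Fin.insertNthEquiv]
      · exact Integrable.of_bound (hg.comp (MeasurableEquiv.measurable _)).aestronglyMeasurable b
          (Filter.Eventually.of_forall fun _ => hb _)
    have hcons : Measurable fun q : W × (Fin n → W) => (Fin.cons q.1 q.2 : Fin (n + 1) → W) := by
      refine measurable_pi_iff.2 fun i => ?_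
      refine Fin.cases ?_ (fun j => ?_) i
      · simpa using measurable_fst
      · simpa [Function.comp_def] using (measurable_pi_apply j).comp measurable_snd
    have hexpb (w) : |Real.exp (f w)| ≤ Real.exp B := by
      rw [Real.abs_exp]; exact Real.exp_le_exp.2 ((le_abs_self _).trans (hB w))
    have hexpl (w) : Real.exp (-B) ≤ Real.exp (f w) := Real.exp_le_exp.2 (neg_le_of_abs_le (hB w))
    have hsec (x : W) : Measurable fun y => f (Fin.cons x y) :=
      hf.comp (hcons.comp measurable_prodMk_left)
    -- With the first coordinate frozen, the induction hypothesis leaves `log (I x)`; the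
    -- one-variable inequality applied to `log ∘ I` then adds one more divergence.
    set I : W → ℝ := fun x => ∫ y, Real.exp (f (Fin.cons x y)) ∂(Measure.pi fun _ => ν) with hI
    have hIm : Measurable I :=
      (StronglyMeasurable.integral_prod_right (f := fun x y => Real.exp (f (Fin.cons x y)))
        (hf.comp hcons).exp.stronglyMeasurable).measurable
    have hint (x : W) : Integrable (fun y => Real.exp (f (Fin.cons x y)))
        (Measure.pi fun _ => ν) :=
      Integrable.of_bound (hsec x).exp.aestronglyMeasurable (Real.exp B)
        (Filter.Eventually.of_forall fun _ => hexpb _)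
    have hIl (x : W) : Real.exp (-B) ≤ I x := by
      have := integral_mono (μ := Measure.pi fun _ : Fin n => ν) (integrable_const _) (hint x)
        (fun y => hexpl (Fin.cons x y))
      simpa using this
    have hIu (x : W) : I x ≤ Real.exp B := by
      have := integral_mono (μ := Measure.pi fun _ : Fin n => ν) (hint x) (integrable_const _)
        (fun y => (le_abs_self _).trans (hexpb (Fin.cons x y)))
      simpa using this
    have hIpos (x : W) : 0 < I x := (Real.exp_pos _).trans_le (hIl x)
    have hlog (x : W) : |Real.log (I x)| ≤ B := by
      refine abs_le.2 ⟨?_, ?_⟩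
      · exact (Real.le_log_iff_exp_le (hIpos x)).2 (hIl x)
      · exact (Real.log_le_iff_le_exp (hIpos x)).2 (hIu x)
    have hdv := integral_le_klDiv_add_log μ ν h hIm.log hlog
    have hstep (x : W) : ∫ y, f (Fin.cons x y) ∂(Measure.pi fun _ => μ) ≤
        n * (klDiv μ ν).toReal + Real.log (I x) := ih (hsec x) fun y => hB _
    rw [split μ hf hB, split ν hf.exp hexpb]
    have hlogint : Integrable (fun x => Real.log (I x)) μ :=
      Integrable.of_bound hIm.log.aestronglyMeasurable B (Filter.Eventually.of_forall hlog)
    have hmono : ∫ x, ∫ y, f (Fin.cons x y) ∂(Measure.pi fun _ => μ) ∂μ ≤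
        ∫ x, (n * (klDiv μ ν).toReal + Real.log (I x)) ∂μ := by
      refine integral_mono ?_ ((integrable_const _).add hlogint) hstep
      refine Integrable.of_bound (C := B) ?_ (Filter.Eventually.of_forall fun x => ?_)
      · exact (StronglyMeasurable.integral_prod_right (f := fun x y => f (Fin.cons x y))
          (hf.comp hcons).stronglyMeasurable).aestronglyMeasurable
      · refine (norm_integral_le_of_norm_le_const (Filter.Eventually.of_forall fun y => hB _)).trans ?_
        simp
    rw [integral_add (integrable_const _) hlogint] at hmono
    simp only [integral_const, probReal_univ, one_smul] at hmono
    have hexplog (x : W) : Real.exp (Real.log (I x)) = I x := Real.exp_log (hIpos x)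
    simp only [hexplog] at hdv
    push_cast
    linarith

/-! ### Hoeffding bounds -/

/-- Hoeffding's lemma for sums of independent copies of a bounded function. -/
theorem hasSubgaussianMGF_pi_sum {Z : Type*} [MeasurableSpace Z] (Q : Measure Z)
    [IsProbabilityMeasure Q] (n : ℕ) {f : Z → ℝ} (hf : Measurable f) {a b : ℝ}
    (hab : ∀ z, f z ∈ Set.Icc a b) :
    HasSubgaussianMGF (fun D : Fin n → Z => ∑ i, (f (D i) - ∫ z, f z ∂Q))
      (n * (‖b - a‖₊ / 2) ^ 2) (Measure.pi fun _ => Q) := by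
  have hind : iIndepFun (fun (i : Fin n) (D : Fin n → Z) => f (D i) - ∫ z, f z ∂Q)
      (Measure.pi fun _ => Q) :=
    iIndepFun_pi (X := fun _ z => f z - ∫ z, f z ∂Q) fun _ => (hf.sub_const _).aemeasurable
  have h := HasSubgaussianMGF.sum_of_iIndepFun hind (c := fun _ => (‖b - a‖₊ / 2) ^ 2)
    (s := Finset.univ) (fun i _ => by
      refine HasSubgaussianMGF.of_map (Y := fun D : Fin n → Z => D i)
        (X := fun z => f z - ∫ z, f z ∂Q) (measurable_pi_apply i).aemeasurable ?_
      rw [(measurePreserving_eval (fun _ : Fin n => Q) i).map_eq]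
      exact hasSubgaussianMGF_of_mem_Icc hf.aemeasurable (Filter.Eventually.of_forall hab))
  simpa using h

/-- **Hoeffding's inequality**: the mean of `n` independent copies of a function with values
in `[a, b]` falls below its expectation by at least `ε` with exponentially small probability. -/
theorem pi_measureReal_sum_le {Z : Type*} [MeasurableSpace Z] (Q : Measure Z)
    [IsProbabilityMeasure Q] {n : ℕ} (hn : 0 < n) {f : Z → ℝ} (hf : Measurable f) {a b : ℝ}
    (hab : ∀ z, f z ∈ Set.Icc a b) (hlt : a < b) {ε : ℝ} (hε : 0 ≤ ε) :
    (Measure.pi fun _ : Fin n => Q).real {D | n * (∫ z, f z ∂Q) + n * ε ≤ ∑ i, f (D i)} ≤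
      Real.exp (-(2 * n * ε ^ 2 / (b - a) ^ 2)) := by
  have h := (hasSubgaussianMGF_pi_sum Q n hf hab).measure_ge_le (ε := n * ε) (by positivity)
  have hn' : (0 : ℝ) < n := by exact_mod_cast hn
  have hba : 0 < b - a := sub_pos.2 hlt
  convert h using 2
  · ext D
    simp only [Finset.sum_sub_distrib, Finset.sum_const, Finset.card_univ, Fintype.card_fin,
      nsmul_eq_mul, Set.mem_ofPred_eq]
    constructor <;> intro h <;> linarith
  · push_cast
    rw [Real.norm_of_nonneg hba.le]
    field_simp

/-! ### Pointwise estimates for the divergence integrand -/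

/-- Apply `log y ≥ 1 - 1/y` at `y = √x`. This Hellinger bound is quadratic near 1 and linear at
infinity; the lower bounds on the divergence below rest on it. -/
theorem sq_sqrt_sub_one_le_klFun {x : ℝ} (hx : 0 ≤ x) : (√x - 1) ^ 2 ≤ klFun x := by
  rcases hx.eq_or_lt with rfl | hx
  · simp [klFun_zero]
  have hs : 0 < √x := Real.sqrt_pos.2 hx
  have h1 := Real.one_sub_inv_le_log_of_pos hs
  have h2 : Real.log x = 2 * Real.log √x := by rw [Real.log_sqrt hx.le]; ring
  have h3 : x = √x * √x := (Real.mul_self_sqrt hx.le).symm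
  have h4 : x * (1 - (√x)⁻¹) = x - √x := by
    have : x * (√x)⁻¹ = √x := by
      rw [h3, Real.sqrt_mul_self hs.le]; field_simp
    rw [mul_sub, this, mul_one]
  rw [klFun_apply, h2]
  nlinarith [mul_le_mul_of_nonneg_left h1 hx.le]

theorem klFun_le_sq {x : ℝ} (hx : 0 ≤ x) : klFun x ≤ (x - 1) ^ 2 := by
  rcases hx.eq_or_lt with rfl | hx
  · simp [klFun_zero]
  rw [klFun_apply]
  nlinarith [mul_le_mul_of_nonneg_left (Real.log_le_sub_one_of_pos hx) hx.le]

/-- Truncation of `r` to the interval `[-τ, τ]`. -/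
noncomputable def truncate (τ r : ℝ) : ℝ := max (-τ) (min τ r)

theorem abs_truncate_le {τ : ℝ} (hτ : 0 ≤ τ) (r : ℝ) : |truncate τ r| ≤ τ :=
  abs_le.2 ⟨le_max_left _ _, max_le (by linarith) (min_le_left _ _)⟩

/-- Where the truncation acts, `|x - 1| ≥ τ` forces `(√x + 1) τ ≤ 7 |√x - 1|`; multiplying by `|√x -
1|` bounds `|x - 1| τ` by `7 (√x - 1)²`. -/
theorem abs_sub_truncate_le_klFun {τ x : ℝ} (hτ : 0 < τ) (hτ' : τ ≤ 1 / 2) (hx : 0 ≤ x) :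
    |x - 1 - truncate τ (x - 1)| ≤ 7 / τ * klFun x := by
  have hk := sq_sqrt_sub_one_le_klFun hx
  have hk0 := klFun_nonneg hx
  set u := √x - 1 with hu
  have hu1 : -1 ≤ u := by have := Real.sqrt_nonneg x; linarith
  have hxu : x - 1 = u * (u + 2) := by
    have := Real.mul_self_sqrt hx
    simp only [hu]; linarith
  rw [div_mul_eq_mul_div, le_div_iff₀ hτ]
  rcases le_total |x - 1| τ with h | h
  · have : truncate τ (x - 1) = x - 1 := by
      rw [truncate, min_eq_right (abs_le.1 h).2, max_eq_right (abs_le.1 h).1]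
    rw [this]; simpa using hk0
  · rcases le_total 0 (x - 1) with h0 | h0
    · rw [abs_of_nonneg h0] at h
      have : truncate τ (x - 1) = τ := by
        rw [truncate, min_eq_left h, max_eq_right (by linarith)]
      rw [this, abs_of_nonneg (by linarith)]
      have hu0 : 0 ≤ u := by nlinarith
      have h2 : (u + 2) * τ ≤ 7 * u := by
        rcases le_total u 1 with h1 | h1 <;> nlinarith
      have h3 := mul_le_mul_of_nonneg_left h2 hu0
      nlinarith
    · rw [abs_of_nonpos h0] at h
      have : truncate τ (x - 1) = -τ := by
        rw [truncate, min_eq_right (by linarith), max_eq_left (by linarith)]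
      rw [this, abs_of_nonpos (by linarith)]
      have hu0 : u ≤ 0 := by nlinarith
      have h2 : (u + 2) * τ ≤ 7 * (-u) := by nlinarith
      have h3 := mul_le_mul_of_nonneg_left h2 (neg_nonneg.2 hu0)
      nlinarith

/-- For `√x ≤ 2`, `|x - 1| ≤ 3 |√x - 1|`; for larger `x` the truncated value is at most 1 while `(√x
- 1)² ≥ 1`. -/
theorem sq_truncate_le_klFun {τ x : ℝ} (hτ : 0 ≤ τ) (hτ' : τ ≤ 1 / 2) (hx : 0 ≤ x) :
    truncate τ (x - 1) ^ 2 ≤ 9 * klFun x := by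
  have hk := sq_sqrt_sub_one_le_klFun hx
  set u := √x - 1 with hu
  have hu1 : -1 ≤ u := by have := Real.sqrt_nonneg x; linarith
  have hxu : x - 1 = u * (u + 2) := by
    have := Real.mul_self_sqrt hx
    simp only [hu]; linarith
  have ht := abs_truncate_le hτ (x - 1)
  rcases le_total u 1 with h1 | h1
  · have h2 : truncate τ (x - 1) ^ 2 ≤ (x - 1) ^ 2 := by
      refine sq_le_sq.2 ?_
      refine abs_le.2 ⟨?_, ?_⟩
      · exact (le_min (by linarith [abs_nonneg (x - 1)]) (neg_abs_le _)).trans (le_max_right _ _)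
      · exact max_le (by linarith [abs_nonneg (x - 1)]) ((min_le_right _ _).trans (le_abs_self _))
    have h3 : (x - 1) ^ 2 ≤ 9 * u ^ 2 := by
      rw [hxu, mul_pow]
      nlinarith [mul_le_mul_of_nonneg_left (show (u + 2) ^ 2 ≤ 9 by nlinarith) (sq_nonneg u)]
    linarith
  · have h2 : truncate τ (x - 1) ^ 2 ≤ 1 := by
      rw [← sq_abs]; nlinarith [abs_nonneg (truncate τ (x - 1))]
    nlinarith

/-! ### Pinsker's inequality and dilation of a posterior -/

section Density

variable {W : Type*} [MeasurableSpace W] {p p₀ : Measure W} [IsProbabilityMeasure p]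
  [IsProbabilityMeasure p₀]

omit [IsProbabilityMeasure p₀] in
theorem integrable_toReal_rnDeriv_mul (φ : W → ℝ) (hφ : Measurable φ) {c : ℝ}
    (hc : ∀ w, |φ w| ≤ c) : Integrable (fun w => (p.rnDeriv p₀ w).toReal * φ w) p₀ :=
  Measure.integrable_toReal_rnDeriv.mul_bdd (c := c) hφ.aestronglyMeasurable
    (Filter.Eventually.of_forall hc)

/-- A weak form of Pinsker's inequality, with a free parameter in place of the square root. -/
theorem abs_integral_sub_integral_le (h : klDiv p p₀ ≠ ⊤) {φ : W → ℝ} (hφ : Measurable φ)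
    {c : ℝ} (hc : ∀ w, |φ w| ≤ c) {t : ℝ} (ht : 0 < t) :
    |∫ w, φ w ∂p - ∫ w, φ w ∂p₀| ≤ c * (t * (klDiv p p₀).toReal / 2 + 2 / t) := by
  obtain ⟨hac, hint⟩ := klDiv_ne_top_iff.1 h
  have hc0 : 0 ≤ c := by
    obtain ⟨w⟩ := nonempty_of_isProbabilityMeasure p
    exact (abs_nonneg _).trans (hc w)
  have hφ0 : Integrable φ p₀ :=
    Integrable.of_bound hφ.aestronglyMeasurable c (Filter.Eventually.of_forall hc)
  have hk := (integrable_klFun_rnDeriv_iff hac).2 hint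
  have hr : Integrable (fun w => (p.rnDeriv p₀ w).toReal) p₀ := Measure.integrable_toReal_rnDeriv
  have hr1 : ∫ w, (p.rnDeriv p₀ w).toReal ∂p₀ = 1 := by
    rw [Measure.integral_toReal_rnDeriv hac]; simp
  have e1 : ∫ w, φ w ∂p = ∫ w, (p.rnDeriv p₀ w).toReal * φ w ∂p₀ := by
    simpa using (integral_rnDeriv_smul (f := φ) hac).symm
  rw [e1, ← integral_sub (integrable_toReal_rnDeriv_mul φ hφ hc) hφ0, toReal_klDiv_eq_integral_klFun hac]
  have hpt (w) : ‖(p.rnDeriv p₀ w).toReal * φ w - φ w‖ ≤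
      c * (t * klFun (p.rnDeriv p₀ w).toReal / 2 + ((p.rnDeriv p₀ w).toReal + 1) / t) := by
    set x := (p.rnDeriv p₀ w).toReal
    have hx : 0 ≤ x := ENNReal.toReal_nonneg
    have hk := sq_sqrt_sub_one_le_klFun hx
    have hs := Real.mul_self_sqrt hx
    have hs0 := Real.sqrt_nonneg x
    -- Weighted AM-GM on `|√x - 1| (√x + 1)`, with `(√x + 1)² ≤ 2 (x + 1)`.
    have : |x - 1| ≤ t * klFun x / 2 + (x + 1) / t := by
      have h1 : |x - 1| = |√x - 1| * (√x + 1) := by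
        rw [show x - 1 = (√x - 1) * (√x + 1) by linarith, abs_mul,
          abs_of_nonneg (show 0 ≤ √x + 1 by linarith)]
      rw [h1, ← sub_nonneg]
      have h2 : t * klFun x / 2 + (x + 1) / t - |√x - 1| * (√x + 1) =
          (t ^ 2 * klFun x + 2 * (x + 1) - 2 * t * (|√x - 1| * (√x + 1))) / (2 * t) := by
        field_simp
      rw [h2]
      refine div_nonneg ?_ (by positivity)
      have h3 : t ^ 2 * |√x - 1| ^ 2 ≤ t ^ 2 * klFun x := by
        rw [sq_abs]; exact mul_le_mul_of_nonneg_left hk (sq_nonneg t)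
      nlinarith [sq_nonneg (t * |√x - 1| - (√x + 1)), sq_nonneg (√x - 1)]
    have e : x * φ w - φ w = (x - 1) * φ w := by ring
    rw [e, Real.norm_eq_abs, abs_mul, mul_comm c]
    exact mul_le_mul this (hc w) (abs_nonneg _) ((abs_nonneg _).trans this)
  have hr' : Integrable (fun w => (p.rnDeriv p₀ w).toReal + 1) p₀ := hr.add (integrable_const 1)
  refine (norm_integral_le_of_norm_le ?_ (Filter.Eventually.of_forall hpt)).trans (le_of_eq ?_)
  · exact (((hk.const_mul t).div_const 2).add (hr'.div_const t)).const_mul c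
  · rw [integral_const_mul, integral_add ((hk.const_mul t).div_const 2)
      (hr'.div_const t), integral_div, integral_div, integral_const_mul,
      integral_add hr (integrable_const 1), hr1]
    simp
    norm_num

/-- For `s ≥ 1`, the displacement `s (p - p₀)` is close to the displacement `p' - p₀` of a
probability measure `p'` whose divergence is at most `9 s²` times that of `p`. -/
theorem exists_dilation (h : klDiv p p₀ ≠ ⊤) {s : ℝ} (hs : 1 ≤ s) :
    ∃ p' : Measure W, IsProbabilityMeasure p' ∧ klDiv p' p₀ ≠ ⊤ ∧
      (klDiv p' p₀).toReal ≤ 9 * s ^ 2 * (klDiv p p₀).toReal ∧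
      ∀ (φ : W → ℝ) (c : ℝ), Measurable φ → (∀ w, |φ w| ≤ c) →
        |s * ∫ w, φ w ∂p - ((s - 1) * ∫ w, φ w ∂p₀ + ∫ w, φ w ∂p')| ≤
          28 * c * s ^ 2 * (klDiv p p₀).toReal := by
  obtain ⟨hac, hint⟩ := klDiv_ne_top_iff.1 h
  have hs0 : 0 < s := by linarith
  have hk := (integrable_klFun_rnDeriv_iff hac).2 hint
  have hr : Integrable (fun w => (p.rnDeriv p₀ w).toReal) p₀ := Measure.integrable_toReal_rnDeriv
  have hr1 : ∫ w, (p.rnDeriv p₀ w).toReal ∂p₀ = 1 := by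
    rw [Measure.integral_toReal_rnDeriv hac]; simp
  have hkl := toReal_klDiv_eq_integral_klFun hac
  set r : W → ℝ := fun w => (p.rnDeriv p₀ w).toReal with hrdef
  have hrm : Measurable r := (Measure.measurable_rnDeriv _ _).ennreal_toReal
  have hr0 (w) : 0 ≤ r w := ENNReal.toReal_nonneg
  set K := (klDiv p p₀).toReal
  -- The largest truncation level keeping `1 + s (v - a)` nonnegative when `|v|, |a| ≤ τ`.
  -- Subtracting the mean `a` restores total mass 1.
  set τ : ℝ := 1 / (2 * s) with hτ
  have hτ0 : 0 < τ := by positivity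
  have hsτ : s * τ = 1 / 2 := by rw [hτ]; field_simp
  have hτ' : τ ≤ 1 / 2 := by nlinarith
  set v : W → ℝ := fun w => truncate τ (r w - 1) with hv
  have hvm : Measurable v := measurable_const.max (measurable_const.min (hrm.sub_const 1))
  have hvb (w) : |v w| ≤ τ := abs_truncate_le hτ0.le _
  have hvi : Integrable v p₀ :=
    Integrable.of_bound hvm.aestronglyMeasurable τ (Filter.Eventually.of_forall hvb)
  have hv2i : Integrable (fun w => v w ^ 2) p₀ := by
    refine Integrable.of_bound (hvm.pow_const 2).aestronglyMeasurable (τ ^ 2)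
      (Filter.Eventually.of_forall fun w => ?_)
    rw [Real.norm_eq_abs, abs_pow]
    exact pow_le_pow_left₀ (abs_nonneg _) (hvb w) 2
  set a := ∫ w, v w ∂p₀ with ha
  have hab : |a| ≤ τ := by
    simpa using norm_integral_le_of_norm_le_const (μ := p₀) (f := v) (Filter.Eventually.of_forall hvb)
  set g : W → ℝ := fun w => 1 + s * (v w - a) with hg
  have hgm : Measurable g := ((hvm.sub_const a).const_mul s).const_add 1
  have hg0 (w) : 0 ≤ g w := by
    have h1 := (abs_le.1 (hvb w)).1
    have h2 := (abs_le.1 hab).2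
    simp only [hg]; nlinarith
  have hgi : Integrable g p₀ := (integrable_const 1).add ((hvi.sub (integrable_const a)).const_mul s)
  have hva : Integrable (fun w => v w - a) p₀ := hvi.sub (integrable_const a)
  have hg1 : ∫ w, g w ∂p₀ = 1 := by
    simp only [hg]
    rw [integral_add (integrable_const _) (hva.const_mul s),
      integral_const_mul, integral_sub hvi (integrable_const a)]
    simp [ha]
  set p' : Measure W := p₀.withDensity fun w => ENNReal.ofReal (g w) with hp'
  have hp'p : IsProbabilityMeasure p' := by
    refine ⟨?_⟩
    rw [hp', withDensity_apply _ MeasurableSet.univ, Measure.restrict_univ,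
      ← ofReal_integral_eq_lintegral_ofReal hgi (Filter.Eventually.of_forall hg0), hg1,
      ENNReal.ofReal_one]
  have hp'ac : p' ≪ p₀ := withDensity_absolutelyContinuous _ _
  have hrn : p'.rnDeriv p₀ =ᵐ[p₀] fun w => ENNReal.ofReal (g w) :=
    Measure.rnDeriv_withDensity _ hgm.ennreal_ofReal
  -- The left side is `s²` times the variance of `v`; it dominates the divergence of `p'` by
  -- `klFun_le_sq`.
  have hvar : ∫ w, (g w - 1) ^ 2 ∂p₀ ≤ 9 * s ^ 2 * K := by
    have e : ∀ w, (g w - 1) ^ 2 = s ^ 2 * (v w ^ 2 - 2 * a * v w + a ^ 2) := fun w => by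
      simp only [hg]; ring
    simp only [e]
    have hq : Integrable (fun w => v w ^ 2 - 2 * a * v w) p₀ := hv2i.sub (hvi.const_mul _)
    rw [integral_const_mul, integral_add hq (integrable_const _),
      integral_sub hv2i (hvi.const_mul _), integral_const_mul, ← ha]
    have h2 : ∫ w, v w ^ 2 ∂p₀ ≤ 9 * K := by
      rw [hkl, ← integral_const_mul]
      exact integral_mono hv2i (hk.const_mul 9) fun w => sq_truncate_le_klFun hτ0.le hτ' (hr0 w)
    simp only [integral_const, probReal_univ, one_smul]
    nlinarith [mul_le_mul_of_nonneg_left (show ∫ w, v w ^ 2 ∂p₀ - 2 * a * a + a ^ 2 ≤ 9 * K by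
      nlinarith) (sq_nonneg s)]
  have hsqi : Integrable (fun w => (g w - 1) ^ 2) p₀ := by
    refine Integrable.of_bound ((hgm.sub_const 1).pow_const 2).aestronglyMeasurable
      ((s * (2 * τ)) ^ 2) (Filter.Eventually.of_forall fun w => ?_)
    rw [Real.norm_eq_abs, abs_pow]
    refine pow_le_pow_left₀ (abs_nonneg _) ?_ 2
    simp only [hg, add_sub_cancel_left]
    rw [abs_mul, abs_of_pos hs0]
    refine mul_le_mul_of_nonneg_left ((abs_sub _ _).trans ?_) hs0.le
    linarith [hvb w]
  have hklb : klDiv p' p₀ ≤ ENNReal.ofReal (9 * s ^ 2 * K) := by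
    rw [klDiv_eq_lintegral_klFun_of_ac hp'ac]
    calc ∫⁻ w, ENNReal.ofReal (klFun (p'.rnDeriv p₀ w).toReal) ∂p₀
        ≤ ∫⁻ w, ENNReal.ofReal ((g w - 1) ^ 2) ∂p₀ := by
          refine lintegral_mono_ae ?_
          filter_upwards [hrn] with w hw
          rw [hw, ENNReal.toReal_ofReal (hg0 w)]
          exact ENNReal.ofReal_le_ofReal (klFun_le_sq (hg0 w))
      _ = ENNReal.ofReal (∫ w, (g w - 1) ^ 2 ∂p₀) :=
          (ofReal_integral_eq_lintegral_ofReal hsqi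
            (Filter.Eventually.of_forall fun w => sq_nonneg _)).symm
      _ ≤ _ := ENNReal.ofReal_le_ofReal hvar
  have hK0 : 0 ≤ K := ENNReal.toReal_nonneg
  refine ⟨p', hp'p, ne_top_of_le_ne_top ENNReal.ofReal_ne_top hklb, ?_, fun φ c hφ hc => ?_⟩
  · exact ENNReal.toReal_le_of_le_ofReal (by positivity) hklb
  have hc0 : 0 ≤ c := by
    obtain ⟨w⟩ := nonempty_of_isProbabilityMeasure p
    exact (abs_nonneg _).trans (hc w)
  have hφ0 : Integrable φ p₀ :=
    Integrable.of_bound hφ.aestronglyMeasurable c (Filter.Eventually.of_forall hc)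
  have hr1i : Integrable (fun w => r w - 1) p₀ := hr.sub (integrable_const 1)
  have hd : Integrable (fun w => r w - 1 - v w) p₀ := hr1i.sub hvi
  have hdb : ∫ w, |r w - 1 - v w| ∂p₀ ≤ 14 * s * K := by
    rw [hkl, ← integral_const_mul]
    refine integral_mono hd.abs (hk.const_mul _) fun w => ?_
    have := abs_sub_truncate_le_klFun hτ0 hτ' (hr0 w)
    have e : 7 / τ = 14 * s := by rw [hτ]; field_simp; norm_num
    rwa [e] at this
  -- Since `r - 1` has mean 0, `a` is minus the mean of the truncation error and obeys the same
  -- bound.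
  have hada : |a| ≤ 14 * s * K := by
    refine le_trans ?_ hdb
    have : a = -∫ w, (r w - 1 - v w) ∂p₀ := by
      rw [integral_sub hr1i hvi, integral_sub hr (integrable_const 1), hr1]
      simp [ha]
    rw [this, abs_neg]
    exact abs_integral_le_integral_abs
  have e1 : ∫ w, φ w ∂p = ∫ w, r w * φ w ∂p₀ := by
    simpa using (integral_rnDeriv_smul (f := φ) hac).symm
  have e2 : ∫ w, φ w ∂p' = ∫ w, g w * φ w ∂p₀ := by
    rw [hp', integral_withDensity_eq_integral_toReal_smul hgm.ennreal_ofReal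
      (Filter.Eventually.of_forall fun _ => ENNReal.ofReal_lt_top)]
    refine integral_congr_ae (Filter.Eventually.of_forall fun w => ?_)
    simp [ENNReal.toReal_ofReal (hg0 w)]
  have hri : Integrable (fun w => r w * φ w) p₀ := integrable_toReal_rnDeriv_mul φ hφ hc
  have hgφ : Integrable (fun w => g w * φ w) p₀ :=
    hgi.mul_bdd (c := c) hφ.aestronglyMeasurable (Filter.Eventually.of_forall hc)
  have hsum : Integrable (fun w => (s - 1) * φ w + g w * φ w) p₀ := (hφ0.const_mul _).add hgφ
  have hdsum : Integrable (fun w => |r w - 1 - v w| + |a|) p₀ := hd.abs.add (integrable_const _)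
  have e3 : s * ∫ w, φ w ∂p - ((s - 1) * ∫ w, φ w ∂p₀ + ∫ w, φ w ∂p') =
      ∫ w, s * (r w - 1 - v w + a) * φ w ∂p₀ := by
    rw [e1, e2, ← integral_const_mul, ← integral_const_mul,
      ← integral_add (hφ0.const_mul _) hgφ, ← integral_sub (hri.const_mul _) hsum]
    refine integral_congr_ae (Filter.Eventually.of_forall fun w => ?_)
    simp only [hg]; ring
  rw [e3]
  have hpt (w) : ‖s * (r w - 1 - v w + a) * φ w‖ ≤ s * c * (|r w - 1 - v w| + |a|) := by
    rw [Real.norm_eq_abs, abs_mul, abs_mul, abs_of_pos hs0, mul_right_comm s c]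
    exact mul_le_mul (mul_le_mul_of_nonneg_left (abs_add_le _ _) hs0.le) (hc w) (abs_nonneg _)
      (by positivity)
  refine (norm_integral_le_of_norm_le (hdsum.const_mul (s * c))
    (Filter.Eventually.of_forall hpt)).trans ?_
  rw [integral_const_mul, integral_add hd.abs (integrable_const _)]
  simp only [integral_const, probReal_univ, one_smul]
  calc s * c * (∫ w, |r w - 1 - v w| ∂p₀ + |a|) ≤ s * c * (14 * s * K + 14 * s * K) := by gcongr
    _ = _ := by ring

end Density

/-! ### Lower brackets for one-parameter families of sets -/

section Brackets

variable {Z : Type*} [MeasurableSpace Z] (Q : Measure Z) [IsProbabilityMeasure Q]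

/-- A sequence of sets which is totally ordered by inclusion has `N + 1` lower brackets of
precision `1 / N`. -/
theorem exists_lower_brackets_of_chain {B : ℕ → Set Z} (hB : ∀ s, MeasurableSet (B s))
    (hchain : ∀ s t, B s ⊆ B t ∨ B t ⊆ B s) {N : ℕ} (hN : 0 < N) :
    ∃ L : Fin (N + 1) → Set Z, (∀ j, MeasurableSet (L j)) ∧
      ∀ s, ∃ j, L j ⊆ B s ∧ Q.real (B s) ≤ Q.real (L j) + 1 / N := by
  have hN' : (0 : ℝ) < N := by exact_mod_cast hN
  -- Bracket `j` is the intersection of all sets with measure in `[j/N, (j+1)/N)`. The chain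
  -- condition makes this family directed, so the intersection keeps measure at least `j/N`. Index
  -- `N` serves sets of full measure.
  refine ⟨fun j => ⋂ s : {s : ℕ // ⌊N * Q.real (B s)⌋₊ = j}, B s,
    fun j => MeasurableSet.iInter fun s => hB s, fun s => ?_⟩
  have hle : ⌊N * Q.real (B s)⌋₊ < N + 1 := by
    refine Nat.lt_succ_of_le (Nat.floor_le_of_le ?_)
    have : Q.real (B s) ≤ 1 := measureReal_le_one
    nlinarith
  refine ⟨⟨_, hle⟩, Set.iInter_subset_of_subset ⟨s, rfl⟩ subset_rfl, ?_⟩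
  set j := ⌊N * Q.real (B s)⌋₊ with hj
  have hdir : Directed (· ⊇ ·) fun t : {t : ℕ // ⌊N * Q.real (B t)⌋₊ = j} => B t := fun a b => by
    rcases hchain a b with h | h
    · exact ⟨a, subset_rfl, h⟩
    · exact ⟨b, h, subset_rfl⟩
  have hmeas := Directed.measure_iInter (μ := Q) (fun t => (hB _).nullMeasurableSet) hdir
    ⟨⟨s, rfl⟩, measure_ne_top _ _⟩
  have hlow : ENNReal.ofReal (j / N) ≤
      Q (⋂ t : {t : ℕ // ⌊N * Q.real (B t)⌋₊ = j}, B t) := by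
    rw [hmeas]
    refine le_iInf fun t => ?_
    rw [← ofReal_measureReal]
    refine ENNReal.ofReal_le_ofReal ((div_le_iff₀ hN').2 ?_)
    have ht : (⌊N * Q.real (B t)⌋₊ : ℝ) = j := congrArg _ t.2
    rw [← ht, mul_comm (Q.real _)]
    exact Nat.floor_le (by positivity)
  have hlow' := (ENNReal.ofReal_le_iff_le_toReal (measure_ne_top _ _)).1 hlow
  have hup : Q.real (B s) ≤ (j + 1) / N := by
    rw [le_div_iff₀ hN', mul_comm]
    exact (Nat.lt_floor_add_one _).le
  rw [add_div] at hup
  exact hup.trans (by gcongr; exact hlow')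

/-- If, for each point, the indices of the sets which miss it form an interval, then the sequence
has `(N + 1) ^ 2` lower brackets of precision `2 / N`. -/
theorem exists_lower_brackets_of_interval {A : ℕ → Set Z} (hA : ∀ s, MeasurableSet (A s))
    (hconv : ∀ z r s t, r ≤ s → s ≤ t → z ∉ A r → z ∉ A t → z ∉ A s) {N : ℕ} (hN : 0 < N) :
    ∃ L : Fin (N + 1) × Fin (N + 1) → Set Z, (∀ j, MeasurableSet (L j)) ∧
      ∀ s, ∃ j, L j ⊆ A s ∧ Q.real (A s) ≤ Q.real (L j) + 2 / N := by
  -- Each `A s` splits into two chains: `P s` decreases, and `A s \ P s` increases, because a point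
  -- missed earlier but present at `s` cannot be missed again.
  set P : ℕ → Set Z := fun s => ⋂ r : {r : ℕ // r ≤ s}, A r with hP
  have hPm (s) : MeasurableSet (P s) := MeasurableSet.iInter fun r => hA r
  have hPanti : Antitone P := fun s t hst z hz =>
    Set.mem_iInter.2 fun r => Set.mem_iInter.1 hz ⟨r, r.2.trans hst⟩
  have hPA (s) : P s ⊆ A s := fun z hz => Set.mem_iInter.1 hz ⟨s, le_rfl⟩
  have hGmono : Monotone fun s => A s \ P s := fun s t hst z hz => by
    refine ⟨?_, fun h => hz.2 (hPanti hst h)⟩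
    by_contra hzt
    obtain ⟨r, hr⟩ : ∃ r : {r : ℕ // r ≤ s}, z ∉ A r := by simpa [hP] using hz.2
    exact hconv z r s t r.2 hst hr hzt hz.1
  obtain ⟨L₁, hL₁, h₁⟩ := exists_lower_brackets_of_chain Q hPm
    (fun s t => (le_total s t).symm.imp (fun h => hPanti h) fun h => hPanti h) hN
  obtain ⟨L₂, hL₂, h₂⟩ := exists_lower_brackets_of_chain Q (fun s => (hA s).diff (hPm s))
    (fun s t => (le_total s t).imp (fun h => hGmono h) fun h => hGmono h) hN
  refine ⟨fun j => L₁ j.1 ∪ L₂ j.2, fun j => (hL₁ _).union (hL₂ _), fun s => ?_⟩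
  obtain ⟨i, hi, hi'⟩ := h₁ s
  obtain ⟨j, hj, hj'⟩ := h₂ s
  refine ⟨(i, j), Set.union_subset (hi.trans (hPA s)) (hj.trans Set.sdiff_subset), ?_⟩
  have hdisj : Disjoint (L₁ i) (L₂ j) := Set.disjoint_sdiff_right.mono hi hj
  have e1 : Q.real (L₁ i ∪ L₂ j) = Q.real (L₁ i) + Q.real (L₂ j) :=
    measureReal_union hdisj (hL₂ j)
  have e2 : Q.real (A s) = Q.real (P s) + Q.real (A s \ P s) := by
    rw [← measureReal_union Set.disjoint_sdiff_right ((hA s).diff (hPm s)),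
      Set.union_sdiff_cancel (hPA s)]
  simp only [e1, e2]
  have : (2 : ℝ) / N = 1 / N + 1 / N := by ring
  linarith

end Brackets

/-! ### Exponential moments of empirical deviations -/

/-- The fraction of the sample points which lie in `A`. -/
noncomputable def empiricalFreq {Z : Type*} {N : ℕ} (D : Fin N → Z) (A : Set Z) : ℝ :=
  (∑ i, A.indicator (fun _ => (1 : ℝ)) (D i)) / N

theorem empiricalFreq_mono {Z : Type*} {N : ℕ} (D : Fin N → Z) {A B : Set Z} (h : A ⊆ B) :
    empiricalFreq D A ≤ empiricalFreq D B := by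
  unfold empiricalFreq
  gcongr

theorem empiricalFreq_nonneg {Z : Type*} {N : ℕ} (D : Fin N → Z) (A : Set Z) :
    0 ≤ empiricalFreq D A :=
  div_nonneg (Finset.sum_nonneg fun _ _ => Set.indicator_nonneg (fun _ _ => zero_le_one) _)
    (Nat.cast_nonneg _)

theorem empiricalFreq_le_one {Z : Type*} {N : ℕ} (D : Fin N → Z) (A : Set Z) :
    empiricalFreq D A ≤ 1 := by
  refine div_le_one_of_le₀ ?_ (Nat.cast_nonneg _)
  refine (Finset.sum_le_sum (g := fun _ => (1 : ℝ)) fun i _ => ?_).trans (by simp)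
  exact Set.indicator_le_self' (fun _ _ => zero_le_one) _

section Deviation

variable {Z : Type*} [MeasurableSpace Z] (Q : Measure Z) [IsProbabilityMeasure Q]

theorem measurable_empiricalFreq {N : ℕ} {A : Set Z} (hA : MeasurableSet A) :
    Measurable fun D : Fin N → Z => empiricalFreq D A :=
  (Finset.measurable_sum _ fun i _ =>
    (measurable_const.indicator hA).comp (measurable_pi_apply i)).div_const _

/-- The centred indicator sum has variance proxy `N/4`; evaluating its moment generating function at
`-k/N` gives `k² / (8N)`. -/
theorem lintegral_exp_deviation_le {N : ℕ} (hN : 0 < N) {A : Set Z} (hA : MeasurableSet A)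
    (k : ℝ) :
    ∫⁻ D : Fin N → Z, ENNReal.ofReal (Real.exp (k * (Q.real A - empiricalFreq D A)))
        ∂(Measure.pi fun _ => Q) ≤ ENNReal.ofReal (Real.exp (k ^ 2 / (8 * N))) := by
  have hN' : (0 : ℝ) < N := by exact_mod_cast hN
  have hsub := hasSubgaussianMGF_pi_sum Q N (f := A.indicator fun _ => (1 : ℝ))
    (measurable_const.indicator hA) (a := 0) (b := 1) fun z =>
      ⟨Set.indicator_nonneg (fun _ _ => zero_le_one) _,
        Set.indicator_le_self' (fun _ _ => zero_le_one) _⟩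
  have hint : ∫ z, A.indicator (fun _ => (1 : ℝ)) z ∂Q = Q.real A := integral_indicator_one hA
  rw [hint] at hsub
  have e (D : Fin N → Z) : k * (Q.real A - empiricalFreq D A) =
      -k / N * ∑ i, (A.indicator (fun _ => (1 : ℝ)) (D i) - Q.real A) := by
    rw [Finset.sum_sub_distrib, Finset.sum_const, Finset.card_univ, Fintype.card_fin,
      nsmul_eq_mul, empiricalFreq]
    field_simp
    ring
  simp only [e]
  rw [← ofReal_integral_eq_lintegral_ofReal (hsub.integrable_exp_mul _)
    (Filter.Eventually.of_forall fun _ => (Real.exp_pos _).le)]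
  refine ENNReal.ofReal_le_ofReal ((hsub.mgf_le (-k / N)).trans (Real.exp_le_exp.2 (le_of_eq ?_)))
  push_cast
  norm_num
  field_simp
  ring

/-- Uniform exponential deviation inequality over a sequence of sets whose complements are
intervals of indices at each point. -/
theorem lintegral_iSup_exp_deviation_le {N : ℕ} (hN : 0 < N) {A : ℕ → Set Z}
    (hA : ∀ s, MeasurableSet (A s))
    (hconv : ∀ z r s t, r ≤ s → s ≤ t → z ∉ A r → z ∉ A t → z ∉ A s) {k : ℝ} (hk : 0 ≤ k) :
    ∫⁻ D : Fin N → Z, ⨆ s, ENNReal.ofReal (Real.exp (k * (Q.real (A s) - empiricalFreq D (A s))))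
        ∂(Measure.pi fun _ => Q) ≤
      ENNReal.ofReal ((N + 1) ^ 2 * Real.exp (2 * k / N + k ^ 2 / (8 * N))) := by
  obtain ⟨L, hL, hLA⟩ := exists_lower_brackets_of_interval Q hA hconv hN
  -- Passing to a lower bracket cannot raise the empirical frequency and lowers the true measure by
  -- at most `2/N`; the supremum is then dominated by a sum over brackets.
  have hpt (D : Fin N → Z) :
      ⨆ s, ENNReal.ofReal (Real.exp (k * (Q.real (A s) - empiricalFreq D (A s)))) ≤
        ∑ j, ENNReal.ofReal (Real.exp (2 * k / N)) *
          ENNReal.ofReal (Real.exp (k * (Q.real (L j) - empiricalFreq D (L j)))) := by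
    refine iSup_le fun s => ?_
    obtain ⟨j, hj, hj'⟩ := hLA s
    refine le_trans ?_ (Finset.single_le_sum (fun _ _ => zero_le) (Finset.mem_univ j))
    rw [← ENNReal.ofReal_mul (Real.exp_pos _).le, ← Real.exp_add]
    refine ENNReal.ofReal_le_ofReal (Real.exp_le_exp.2 ?_)
    have h1 := empiricalFreq_mono D hj
    have : k * (Q.real (A s) - empiricalFreq D (A s)) ≤
        k * (2 / N + (Q.real (L j) - empiricalFreq D (L j))) :=
      mul_le_mul_of_nonneg_left (by linarith) hk
    refine this.trans (le_of_eq ?_)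
    ring
  have hm (j) : Measurable fun D : Fin N → Z => ENNReal.ofReal (Real.exp (2 * k / N)) *
          ENNReal.ofReal (Real.exp (k * (Q.real (L j) - empiricalFreq D (L j)))) :=
    (((measurable_const.sub (measurable_empiricalFreq (hL j))).const_mul k).exp.ennreal_ofReal).const_mul _
  refine (lintegral_mono hpt).trans ?_
  rw [lintegral_finsetSum _ fun j _ => hm j]
  have hterm (j) : ∫⁻ D : Fin N → Z, ENNReal.ofReal (Real.exp (2 * k / N)) *
          ENNReal.ofReal (Real.exp (k * (Q.real (L j) - empiricalFreq D (L j))))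
          ∂(Measure.pi fun _ => Q) ≤
        ENNReal.ofReal (Real.exp (2 * k / N + k ^ 2 / (8 * N))) := by
    rw [lintegral_const_mul' _ _ ENNReal.ofReal_ne_top, Real.exp_add,
      ENNReal.ofReal_mul (Real.exp_pos _).le]
    gcongr
    exact lintegral_exp_deviation_le Q hN (hL j) k
  refine (Finset.sum_le_sum fun j _ => hterm j).trans (le_of_eq ?_)
  rw [Finset.sum_const, Finset.card_univ, Fintype.card_prod, Fintype.card_fin, nsmul_eq_mul,
    ENNReal.ofReal_mul (by positivity)]
  congr 1
  rw [show ((N : ℝ) + 1) ^ 2 = (((N + 1) * (N + 1) : ℕ) : ℝ) by push_cast; ring,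
    ENNReal.ofReal_natCast]

end Deviation

/-- Simultaneous Markov inequality for finitely many nonnegative functions. -/
theorem exists_measurableSet_forall_le {Ω J : Type*} [MeasurableSpace Ω] [Fintype J] [Nonempty J]
    (μ : Measure Ω) [IsProbabilityMeasure μ] {I : J → Ω → ENNReal} (hI : ∀ j, Measurable (I j))
    {b : J → ℝ} (hb : ∀ j, 0 < b j) (hIb : ∀ j, ∫⁻ ω, I j ω ∂μ ≤ ENNReal.ofReal (b j))
    {δ : ℝ} (hδ : 0 < δ) :
    ∃ E : Set Ω, MeasurableSet E ∧ 1 - δ ≤ μ.real E ∧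
      ∀ ω ∈ E, ∀ j, I j ω ≤ ENNReal.ofReal (Fintype.card J * b j / δ) := by
  have hJ : (0 : ℝ) < Fintype.card J := by exact_mod_cast Fintype.card_pos
  set U : J → Set Ω := fun j => {ω | ENNReal.ofReal (Fintype.card J * b j / δ) ≤ I j ω} with hU
  have hUm (j) : MeasurableSet (U j) := measurableSet_le measurable_const (hI j)
  have hUb (j) : μ.real (U j) ≤ δ / Fintype.card J := by
    have h1 := (mul_meas_ge_le_lintegral (μ := μ) (hI j)
      (ENNReal.ofReal (Fintype.card J * b j / δ))).trans (hIb j)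
    have hbj := hb j
    have hx : 0 < Fintype.card J * b j / δ := by positivity
    rw [← ofReal_measureReal, ← ENNReal.ofReal_mul hx.le, ENNReal.ofReal_le_ofReal_iff hbj.le] at h1
    rw [le_div_iff₀ hJ]
    have h2 : (Fintype.card J * b j / δ) * μ.real (U j) = b j * ((μ.real (U j) * Fintype.card J) / δ) := by
      ring
    have h3 : b j * ((μ.real (U j) * Fintype.card J) / δ) ≤ b j * 1 := by
      rw [← h2, mul_one]; exact h1
    have h4 := le_of_mul_le_mul_left h3 hbj
    rwa [div_le_one hδ] at h4
  refine ⟨(⋃ j, U j)ᶜ, (MeasurableSet.iUnion hUm).compl, ?_, fun ω hω j => ?_⟩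
  · rw [probReal_compl_eq_one_sub (MeasurableSet.iUnion hUm)]
    have h1 := (measureReal_iUnion_fintype_le (μ := μ) U).trans
      (Finset.sum_le_sum fun j _ => hUb j)
    rw [Finset.sum_const, Finset.card_univ, nsmul_eq_mul, mul_div_cancel₀ _ hJ.ne'] at h1
    linarith
  · by_contra hlt
    exact hω (Set.mem_iUnion.2 ⟨j, (not_le.1 hlt).le⟩)

/-! ### Exponential moments under the prior and change of measure -/

section Sections

variable {V Z : Type*} [MeasurableSpace V] [MeasurableSpace Z] (Q : Measure Z)
  [IsProbabilityMeasure Q] {N : ℕ}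

theorem measurable_measureReal_section {A : Set (V × Z)} (hA : MeasurableSet A) :
    Measurable fun v => Q.real (Prod.mk v ⁻¹' A) :=
  (measurable_measure_prodMk_left hA).ennreal_toReal

theorem measurable_empiricalFreq_section {A : Set (V × Z)} (hA : MeasurableSet A) :
    Measurable fun q : V × (Fin N → Z) => empiricalFreq q.2 (Prod.mk q.1 ⁻¹' A) := by
  refine (Finset.measurable_sum _ fun i _ => ?_).div_const _
  have : Measurable fun q : V × (Fin N → Z) => A.indicator (fun _ => (1 : ℝ)) (q.1, q.2 i) :=
    (measurable_const.indicator hA).comp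
      (measurable_fst.prodMk ((measurable_pi_apply i).comp measurable_snd))
  exact this

theorem measurable_deviation {A : Set (V × Z)} (hA : MeasurableSet A) :
    Measurable fun q : V × (Fin N → Z) =>
      Q.real (Prod.mk q.1 ⁻¹' A) - empiricalFreq q.2 (Prod.mk q.1 ⁻¹' A) :=
  ((measurable_measureReal_section Q hA).comp measurable_fst).sub
    (measurable_empiricalFreq_section hA)

theorem abs_deviation_le (A : Set Z) (D : Fin N → Z) : |Q.real A - empiricalFreq D A| ≤ 1 := by
  have h1 := empiricalFreq_nonneg D A
  have h2 := empiricalFreq_le_one D A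
  have h3 : Q.real A ≤ 1 := measureReal_le_one
  have h4 : 0 ≤ Q.real A := measureReal_nonneg
  exact abs_le.2 ⟨by linarith, by linarith⟩

theorem measurable_iSup_exp_deviation {A : ℕ → Set (V × Z)} (hA : ∀ s, MeasurableSet (A s))
    (k : ℝ) :
    Measurable fun q : V × (Fin N → Z) => ⨆ s, ENNReal.ofReal (Real.exp
      (k * (Q.real (Prod.mk q.1 ⁻¹' A s) - empiricalFreq q.2 (Prod.mk q.1 ⁻¹' A s)))) :=
  Measurable.iSup fun s => ((measurable_deviation Q (hA s)).const_mul k).exp.ennreal_ofReal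

/-- The brackets depend on `v`, so Tonelli is used to average over the data first, for each fixed
`v`. -/
theorem lintegral_lintegral_iSup_exp_deviation_le (ν : Measure V) [IsProbabilityMeasure ν]
    (hN : 0 < N) {A : ℕ → Set (V × Z)} (hA : ∀ s, MeasurableSet (A s))
    (hconv : ∀ q r s t, r ≤ s → s ≤ t → q ∉ A r → q ∉ A t → q ∉ A s) {k : ℝ} (hk : 0 ≤ k) :
    ∫⁻ D : Fin N → Z, ∫⁻ v, ⨆ s, ENNReal.ofReal (Real.exp
        (k * (Q.real (Prod.mk v ⁻¹' A s) - empiricalFreq D (Prod.mk v ⁻¹' A s)))) ∂ν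
        ∂(Measure.pi fun _ => Q) ≤
      ENNReal.ofReal ((N + 1) ^ 2 * Real.exp (2 * k / N + k ^ 2 / (8 * N))) := by
  rw [← lintegral_lintegral_swap (f := fun v (D : Fin N → Z) => ⨆ s, ENNReal.ofReal (Real.exp
        (k * (Q.real (Prod.mk v ⁻¹' A s) - empiricalFreq D (Prod.mk v ⁻¹' A s)))))
    (measurable_iSup_exp_deviation Q hA k).aemeasurable]
  refine (lintegral_mono fun v => lintegral_iSup_exp_deviation_le Q hN
    (fun s => measurable_prodMk_left (hA s))
    (fun z r s t hrs hst => hconv (v, z) r s t hrs hst) hk).trans ?_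
  simp

/-- Change of measure: a bound on the exponential moment of the deviations under a product prior
controls the mean deviation under every product posterior. -/
theorem integral_deviation_le {W : Type*} [MeasurableSpace W] {p p₀ : Measure W}
    [IsProbabilityMeasure p] [IsProbabilityMeasure p₀] (h : klDiv p p₀ ≠ ⊤) {T : ℕ}
    {A : ℕ → Set ((Fin T → W) × Z)} (hA : ∀ s, MeasurableSet (A s)) {k b : ℝ} (hk : 0 < k)
    (hb : 0 < b) (D : Fin N → Z)
    (hD : ∫⁻ v, ⨆ s, ENNReal.ofReal (Real.exp (k * (Q.real (Prod.mk v ⁻¹' A s) -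
        empiricalFreq D (Prod.mk v ⁻¹' A s)))) ∂(Measure.pi fun _ => p₀) ≤ ENNReal.ofReal b)
    (s : ℕ) :
    ∫ v, (Q.real (Prod.mk v ⁻¹' A s) - empiricalFreq D (Prod.mk v ⁻¹' A s))
        ∂(Measure.pi fun _ => p) ≤ (T * (klDiv p p₀).toReal + Real.log b) / k := by
  set f : (Fin T → W) → ℝ := fun v =>
    k * (Q.real (Prod.mk v ⁻¹' A s) - empiricalFreq D (Prod.mk v ⁻¹' A s)) with hf
  have hfm : Measurable f :=
    ((measurable_deviation Q (hA s)).comp measurable_prodMk_right).const_mul k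
  have hfb (v) : |f v| ≤ k := by
    simp only [hf]
    rw [abs_mul, abs_of_pos hk]
    exact mul_le_of_le_one_right hk.le (abs_deviation_le Q _ D)
  have hdv := integral_pi_le_klDiv_add_log p p₀ h T hfm hfb
  have hexpi : Integrable (fun v => Real.exp (f v)) (Measure.pi fun _ : Fin T => p₀) := by
    refine Integrable.of_bound hfm.exp.aestronglyMeasurable (Real.exp k)
      (Filter.Eventually.of_forall fun v => ?_)
    rw [Real.norm_eq_abs, Real.abs_exp]
    exact Real.exp_le_exp.2 ((le_abs_self _).trans (hfb v))
  have h1 : ∫ v, Real.exp (f v) ∂(Measure.pi fun _ : Fin T => p₀) ≤ b := by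
    rw [← ENNReal.ofReal_le_ofReal_iff hb.le, ofReal_integral_eq_lintegral_ofReal hexpi
      (Filter.Eventually.of_forall fun v => (Real.exp_pos _).le)]
    -- The supremum sits inside the moment, so `s` may be chosen after the data.
    exact (lintegral_mono fun v => le_iSup (fun s => ENNReal.ofReal (Real.exp
      (k * (Q.real (Prod.mk v ⁻¹' A s) - empiricalFreq D (Prod.mk v ⁻¹' A s))))) s).trans hD
  have h2 := Real.log_le_log (integral_exp_pos hexpi) h1
  rw [le_div_iff₀ hk, mul_comm, ← integral_const_mul]
  linarith

end Sections

/-! ### Margins as pairwise score differences -/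

section Margin

variable {X Y : Type*} [Fintype Y] [Nontrivial Y]

theorem margin_le_iff (h : X → Y → ℝ) (x : X) (y : Y) (t : ℝ) :
    margin h x y ≤ t ↔ ∃ y', y' ≠ y ∧ h x y - h x y' ≤ t := by
  obtain ⟨y₀, hy₀⟩ := exists_ne y
  have : Nonempty {y' : Y // y' ≠ y} := ⟨⟨y₀, hy₀⟩⟩
  have hbdd : BddAbove (Set.range fun y' : {y' : Y // y' ≠ y} => h x y') :=
    (Set.finite_range _).bddAbove
  unfold margin
  constructor
  · intro hm
    obtain ⟨y', hy'⟩ := exists_eq_ciSup_of_finite (f := fun y' : {y' : Y // y' ≠ y} => h x y')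
    exact ⟨y', y'.2, by rw [hy']; exact hm⟩
  · rintro ⟨y', hne, hy'⟩
    have := le_ciSup hbdd ⟨y', hne⟩
    simp only at this
    linarith

theorem lt_margin_iff (h : X → Y → ℝ) (x : X) (y : Y) (t : ℝ) :
    t < margin h x y ↔ ∀ y', y' ≠ y → t < h x y - h x y' := by
  rw [← not_le, margin_le_iff]
  push Not
  rfl

variable [MeasurableSpace X] [MeasurableSpace Y] [MeasurableSingletonClass Y]

theorem measurableSet_margin_le {Ω : Type*} [MeasurableSpace Ω] {Φ : Ω → X → Y → ℝ}
    (hΦ : Measurable fun q : Ω × X × Y => Φ q.1 q.2.1 q.2.2) (t : ℝ) :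
    MeasurableSet {q : Ω × (X × Y) | margin (Φ q.1) q.2.1 q.2.2 ≤ t} := by
  have e : {q : Ω × (X × Y) | margin (Φ q.1) q.2.1 q.2.2 ≤ t} =
      ⋃ y', {q : Ω × (X × Y) | y' ≠ q.2.2} ∩
        {q | Φ q.1 q.2.1 q.2.2 - Φ q.1 q.2.1 y' ≤ t} := by
    ext q
    simp [margin_le_iff]
  rw [e]
  refine MeasurableSet.iUnion fun y' => MeasurableSet.inter ?_ ?_
  · exact (measurable_snd.comp measurable_snd) (Set.toFinite {y : Y | y' ≠ y}).measurableSet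
  · have hm : Measurable fun q : Ω × X × Y => (q.1, q.2.1, y') :=
      measurable_fst.prodMk ((measurable_fst.comp measurable_snd).prodMk measurable_const)
    exact measurableSet_le (hΦ.sub (hΦ.comp hm)) measurable_const

end Margin

/-! ### Approximating a predictor by sampled parameters -/

section Sampling

variable {W X Y : Type*} [MeasurableSpace W] [MeasurableSpace X] [MeasurableSpace Y]
  {F : W → X → Y → ℝ}

theorem measurable_averagePredictor (hF : Measurable fun a : W × X × Y => F a.1 a.2.1 a.2.2)
    (p : Measure W) [IsProbabilityMeasure p] :
    Measurable fun z : X × Y => averagePredictor p F z.1 z.2 :=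
  (StronglyMeasurable.integral_prod_left' (f := fun a : W × (X × Y) => F a.1 a.2.1 a.2.2)
    hF.stronglyMeasurable).measurable

theorem measurable_apply_apply (hF : Measurable fun a : W × X × Y => F a.1 a.2.1 a.2.2)
    (x : X) (y : Y) : Measurable fun w => F w x y :=
  hF.comp (measurable_prodMk_right (y := (x, y)))

/-- The average of the discriminant functions with parameters `w 0, …, w (T - 1)`, shifted by `b`. -/
noncomputable def sampledPredictor (F : W → X → Y → ℝ) {T : ℕ} (b : X → Y → ℝ) (w : Fin T → W)
    (x : X) (y : Y) : ℝ :=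
  b x y + (∑ i, F (w i) x y) / T

theorem measurable_sampledPredictor
    (hF : Measurable fun a : W × X × Y => F a.1 a.2.1 a.2.2) {T : ℕ} {b : X → Y → ℝ}
    (hb : Measurable fun z : X × Y => b z.1 z.2) :
    Measurable fun q : (Fin T → W) × X × Y => sampledPredictor F b q.1 q.2.1 q.2.2 := by
  refine (hb.comp measurable_snd).add ((Finset.measurable_sum _ fun i _ => ?_).div_const _)
  have hm : Measurable fun q : (Fin T → W) × X × Y => (q.1 i, q.2) :=
    ((measurable_pi_apply i).comp measurable_fst).prodMk measurable_snd
  exact hF.comp hm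

/-- The pairs of a parameter sample and an example on which the sampled predictor has margin at
most `θ`. -/
def sampledMarginSet (F : W → X → Y → ℝ) (T : ℕ) (b : X → Y → ℝ) (θ : ℝ) :
    Set ((Fin T → W) × (X × Y)) :=
  {q | margin (sampledPredictor F b q.1) q.2.1 q.2.2 ≤ θ}

variable {c : ℝ} (hc : 0 < c) (hF : Measurable fun a : W × X × Y => F a.1 a.2.1 a.2.2)
  (hFc : ∀ w x y, |F w x y| ≤ c) (p : Measure W) [IsProbabilityMeasure p]

include hF hFc in
theorem integral_sub_eq_averagePredictor_sub (x : X) (y y' : Y) :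
    ∫ w, (F w x y - F w x y') ∂p = averagePredictor p F x y - averagePredictor p F x y' :=
  integral_sub
    (Integrable.of_bound (measurable_apply_apply hF x y).aestronglyMeasurable c
      (Filter.Eventually.of_forall fun w => hFc w x y))
    (Integrable.of_bound (measurable_apply_apply hF x y').aestronglyMeasurable c
      (Filter.Eventually.of_forall fun w => hFc w x y'))

include hc hF hFc in
/-- Concentration of the score difference of two labels under sampling of the parameters. -/
theorem pi_measureReal_score_difference_le {T : ℕ} (hT : 0 < T) {ε : ℝ} (hε : 0 ≤ ε) (x : X)
    (y y' : Y) :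
    (Measure.pi fun _ : Fin T => p).real
        {w | averagePredictor p F x y - averagePredictor p F x y' + ε ≤
          (∑ i, F (w i) x y) / T - (∑ i, F (w i) x y') / T} ≤
      Real.exp (-(T * ε ^ 2 / (8 * c ^ 2))) := by
  have hT' : (0 : ℝ) < T := by exact_mod_cast hT
  have h := pi_measureReal_sum_le p hT (f := fun w => F w x y - F w x y')
    ((measurable_apply_apply hF x y).sub (measurable_apply_apply hF x y'))
    (a := -(2 * c)) (b := 2 * c) (fun w => by
      have h1 := abs_le.1 (hFc w x y)
      have h2 := abs_le.1 (hFc w x y')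
      exact ⟨by linarith [h1.1, h2.2], by linarith [h1.2, h2.1]⟩) (by linarith) hε
  rw [integral_sub_eq_averagePredictor_sub hF hFc] at h
  convert h using 2
  · ext w
    simp only [Set.mem_ofPred_eq, Finset.sum_sub_distrib]
    rw [← sub_div, le_div_iff₀ hT', ← mul_add, mul_comm]
  · field_simp
    ring

variable [Fintype Y] [Nontrivial Y]

include hc hF hFc in
theorem pi_measureReal_lt_margin_le {T : ℕ} (hT : 0 < T) {ε θ : ℝ} (hε : 0 ≤ ε) (b : X → Y → ℝ)
    {x : X} {y y' : Y} (hy : y' ≠ y)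
    (h : (b x y + averagePredictor p F x y) - (b x y' + averagePredictor p F x y') ≤ θ - ε) :
    (Measure.pi fun _ : Fin T => p).real {w | θ < margin (sampledPredictor F b w) x y} ≤
      Real.exp (-(T * ε ^ 2 / (8 * c ^ 2))) := by
  refine (measureReal_mono fun w hw => ?_).trans
    (pi_measureReal_score_difference_le hc hF hFc p hT hε x y y')
  have := (lt_margin_iff _ _ _ _).1 hw y' hy
  simp only [sampledPredictor] at this
  simp only [Set.mem_ofPred_eq]
  linarith

include hc hF hFc in
-- Any competing label may spoil the margin, hence a union bound and the factor `|Y|`; in the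
-- opposite direction a single competitor suffices.
theorem pi_measureReal_margin_le_le {T : ℕ} (hT : 0 < T) {ε θ : ℝ} (hε : 0 ≤ ε) (b : X → Y → ℝ)
    {x : X} {y : Y} (h : ∀ y', y' ≠ y →
      θ + ε ≤ (b x y + averagePredictor p F x y) - (b x y' + averagePredictor p F x y')) :
    (Measure.pi fun _ : Fin T => p).real {w | margin (sampledPredictor F b w) x y ≤ θ} ≤
      Fintype.card Y * Real.exp (-(T * ε ^ 2 / (8 * c ^ 2))) := by
  have h1 : {w : Fin T → W | margin (sampledPredictor F b w) x y ≤ θ} ⊆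
      ⋃ y', {w | averagePredictor p F x y' - averagePredictor p F x y + ε ≤
          (∑ i, F (w i) x y') / T - (∑ i, F (w i) x y) / T} := fun w hw => by
    obtain ⟨y', hne, hy'⟩ := (margin_le_iff _ _ _ _).1 hw
    refine Set.mem_iUnion.2 ⟨y', ?_⟩
    have := h y' hne
    simp only [sampledPredictor] at hy'
    simp only [Set.mem_ofPred_eq]
    linarith
  refine (measureReal_mono h1).trans ((measureReal_iUnion_fintype_le _).trans ?_)
  refine (Finset.sum_le_sum fun y' _ =>
    pi_measureReal_score_difference_le hc hF hFc p hT hε x y' y).trans ?_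
  simp

variable [MeasurableSingletonClass Y]

include hF in
theorem measurableSet_sampledMarginSet (T : ℕ) {b : X → Y → ℝ}
    (hb : Measurable fun z : X × Y => b z.1 z.2) (θ : ℝ) :
    MeasurableSet (sampledMarginSet F T b θ) :=
  measurableSet_margin_le (measurable_sampledPredictor hF hb) θ

include hc hF hFc in
/-- The margin error of a predictor `g` is controlled by the mean margin error of the sampled
predictors whose mean is `H = b + h_p`, provided nonpositive margins of `g` are margins of `H`
below `θ - ε`. -/
theorem trueMarginError_le_integral_sampled (Q : Measure (X × Y)) [IsProbabilityMeasure Q]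
    {T : ℕ} (hT : 0 < T) {ε θ : ℝ} (hε : 0 ≤ ε) {b : X → Y → ℝ}
    (hb : Measurable fun z : X × Y => b z.1 z.2) {g : X → Y → ℝ}
    (hg : Measurable fun z : X × Y => g z.1 z.2)
    (h : ∀ x y y', g x y - g x y' ≤ 0 →
      (b x y + averagePredictor p F x y) - (b x y' + averagePredictor p F x y') ≤ θ - ε) :
    trueMarginError Q g 0 ≤
      ∫ w, Q.real (Prod.mk w ⁻¹' sampledMarginSet F T b θ) ∂(Measure.pi fun _ : Fin T => p) +
        Real.exp (-(T * ε ^ 2 / (8 * c ^ 2))) := by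
  set π := Measure.pi fun _ : Fin T => p
  set A := sampledMarginSet F T b θ
  have hA : MeasurableSet A := measurableSet_sampledMarginSet hF T hb θ
  set η := Real.exp (-(T * ε ^ 2 / (8 * c ^ 2)))
  set u : X × Y → ℝ := fun z => π.real ((fun w => (w, z)) ⁻¹' A) with hu
  have hum : Measurable u := (measurable_measure_prodMk_right hA).ennreal_toReal
  have hui : Integrable u Q := by
    refine Integrable.of_bound hum.aestronglyMeasurable 1 (Filter.Eventually.of_forall fun z => ?_)
    rw [Real.norm_eq_abs, abs_of_nonneg measureReal_nonneg]
    exact measureReal_le_one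
  -- Fubini reduces the claim to one example at a time, where concentration in `w` applies.
  have hswap : ∫ w, Q.real (Prod.mk w ⁻¹' A) ∂π = ∫ z, u z ∂Q := by
    have e1 : ∫ w, Q.real (Prod.mk w ⁻¹' A) ∂π = ((π.prod Q) A).toReal := by
      rw [Measure.prod_apply hA]
      exact integral_toReal (measurable_measure_prodMk_left hA).aemeasurable
        (Filter.Eventually.of_forall fun _ => measure_lt_top _ _)
    have e2 : ∫ z, u z ∂Q = ((π.prod Q) A).toReal := by
      rw [Measure.prod_apply_symm hA]
      exact integral_toReal (measurable_measure_prodMk_right hA).aemeasurable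
        (Filter.Eventually.of_forall fun _ => measure_lt_top _ _)
    rw [e1, e2]
  rw [hswap]
  set S : Set (X × Y) := {z | margin g z.1 z.2 ≤ 0} with hS
  have hSm : MeasurableSet S :=
    (measurableSet_margin_le (Ω := Unit) (Φ := fun _ => g) (hg.comp measurable_snd) 0).preimage
      (measurable_prodMk_left (x := ()))
  have hpt (z) : S.indicator (fun _ => (1 : ℝ)) z ≤ u z + η := by
    by_cases hz : z ∈ S
    · rw [Set.indicator_of_mem hz]
      obtain ⟨y', hne, hy'⟩ := (margin_le_iff _ _ _ _).1 hz
      have h1 := pi_measureReal_lt_margin_le hc hF hFc p hT hε b hne (h _ _ _ hy')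
      have e : {w : Fin T → W | θ < margin (sampledPredictor F b w) z.1 z.2} =
          ((fun w => (w, z)) ⁻¹' A)ᶜ := by
        ext w
        simp [A, sampledMarginSet]
      rw [e, probReal_compl_eq_one_sub (measurable_prodMk_right hA)] at h1
      linarith
    · rw [Set.indicator_of_notMem hz]
      exact add_nonneg measureReal_nonneg (Real.exp_pos _).le
  have : trueMarginError Q g 0 = ∫ z, S.indicator (fun _ => (1 : ℝ)) z ∂Q :=
    (integral_indicator_one hSm).symm
  rw [this]
  refine (integral_mono ((integrable_const _).indicator hSm) (hui.add (integrable_const η))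
    hpt).trans (le_of_eq ?_)
  rw [integral_add' hui (integrable_const η)]
  simp

include hc hF hFc in
-- Sample points of margin at most `γ` are charged 1 each; every other point contributes only the
-- sampling tail.
theorem integral_sampled_le_empiricalMarginError {N : ℕ} (D : Fin N → X × Y) {T : ℕ} (hT : 0 < T)
    {ε θ γ : ℝ} (hε : 0 ≤ ε) {b : X → Y → ℝ} (hb : Measurable fun z : X × Y => b z.1 z.2)
    {g : X → Y → ℝ} (h : ∀ x y y', γ < g x y - g x y' →
      θ + ε ≤ (b x y + averagePredictor p F x y) - (b x y' + averagePredictor p F x y')) :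
    ∫ w, empiricalFreq D (Prod.mk w ⁻¹' sampledMarginSet F T b θ)
        ∂(Measure.pi fun _ : Fin T => p) ≤
      empiricalMarginError D g γ + Fintype.card Y * Real.exp (-(T * ε ^ 2 / (8 * c ^ 2))) := by
  classical
  set π := Measure.pi fun _ : Fin T => p
  set A := sampledMarginSet F T b θ
  have hA : MeasurableSet A := measurableSet_sampledMarginSet hF T hb θ
  set η := Fintype.card Y * Real.exp (-(T * ε ^ 2 / (8 * c ^ 2)))
  have hη : 0 ≤ η := mul_nonneg (Nat.cast_nonneg _) (Real.exp_pos _).le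
  have hsec (z : X × Y) : MeasurableSet ((fun w : Fin T → W => (w, z)) ⁻¹' A) :=
    measurable_prodMk_right hA
  have hint : ∫ w, empiricalFreq D (Prod.mk w ⁻¹' A) ∂π =
      (∑ i, π.real ((fun w => (w, D i)) ⁻¹' A)) / N := by
    unfold empiricalFreq
    rw [integral_div, integral_finsetSum]
    · congr 1
      exact Finset.sum_congr rfl fun i _ => integral_indicator_one (hsec (D i))
    · exact fun i _ => (integrable_const (1 : ℝ)).indicator (hsec (D i))
  rw [hint]
  have hpt (i : Fin N) : π.real ((fun w => (w, D i)) ⁻¹' A) ≤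
      (if margin g (D i).1 (D i).2 ≤ γ then 1 else 0) + η := by
    split_ifs with hm
    · have : π.real ((fun w => (w, D i)) ⁻¹' A) ≤ 1 := measureReal_le_one
      linarith
    · rw [zero_add]
      exact pi_measureReal_margin_le_le hc hF hFc p hT hε b fun y' hne =>
        h _ _ _ ((lt_margin_iff _ _ _ _).1 (not_le.1 hm) y' hne)
  have hsum := Finset.sum_le_sum fun i (_ : i ∈ Finset.univ) => hpt i
  rw [Finset.sum_add_distrib, Finset.sum_boole] at hsum
  simp only [Finset.sum_const, Finset.card_univ, Fintype.card_fin, nsmul_eq_mul] at hsum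
  have hdiv := div_le_div_of_nonneg_right hsum (Nat.cast_nonneg (α := ℝ) N)
  refine hdiv.trans ?_
  rw [add_div]
  refine add_le_add (le_of_eq ?_) ?_
  · unfold empiricalMarginError
    congr
  · rw [mul_comm, mul_div_assoc]
    exact mul_le_of_le_one_right hη (div_self_le_one _)

end Sampling

/-! ### Quantiles and the case of one example -/

theorem measurable_measureReal_lt {Z : Type*} [MeasurableSpace Z] (Q : Measure Z)
    [IsProbabilityMeasure Q] {f : Z → ℝ} (hf : Measurable f) :
    Measurable fun z => Q.real {z' | f z' < f z} := by
  have hmono : Monotone fun t : ℝ => Q.real {z' | f z' < t} := fun a b hab =>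
    measureReal_mono fun z (hz : f z < a) => hz.trans_le hab
  exact hmono.measurable.comp hf

/-- The points below which `f` has mass at most `s` have mass at least `s`. -/
theorem le_measureReal_quantile {Z : Type*} [MeasurableSpace Z] (Q : Measure Z)
    [IsProbabilityMeasure Q] {f : Z → ℝ} (hf : Measurable f) {s : ℝ} (hs : s ≤ 1) :
    s ≤ Q.real {z | Q.real {z' | f z' < f z} ≤ s} := by
  set G : ℝ → ℝ := fun t => Q.real {z' | f z' < t} with hG
  have hmono : Monotone G := fun a b hab =>
    measureReal_mono fun z (hz : f z < a) => hz.trans_le hab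
  have htail {t : ℝ} (ht : s < G t) : Q {z | t ≤ f z} ≤ ENNReal.ofReal (1 - s) := by
    have e : {z | t ≤ f z} = {z | f z < t}ᶜ := by ext z; simp
    rw [← ofReal_measureReal, e, probReal_compl_eq_one_sub (measurableSet_lt hf measurable_const)]
    refine ENNReal.ofReal_le_ofReal ?_
    simp only [hG] at ht
    linarith
  have hm : MeasurableSet {z | G (f z) ≤ s} :=
    measurableSet_le (hmono.measurable.comp hf) measurable_const
  suffices h : Q {z | G (f z) ≤ s}ᶜ ≤ ENNReal.ofReal (1 - s) by
    have h1 : Q.real {z | G (f z) ≤ s}ᶜ ≤ 1 - s :=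
      ENNReal.toReal_le_of_le_ofReal (by linarith) h
    rw [probReal_compl_eq_one_sub hm] at h1
    change s ≤ Q.real {z | G (f z) ≤ s}
    linarith
  -- The complement lies in one upper level set of `f` if `{t | s < G t}` has a least element, and
  -- otherwise in a directed union of upper level sets at rational levels.
  by_cases hleast : ∃ a, s < G a ∧ ∀ t, s < G t → a ≤ t
  · obtain ⟨a, ha, hmin⟩ := hleast
    refine (measure_mono fun z hz => ?_).trans (htail ha)
    exact hmin _ (by simpa using hz)
  · push Not at hleast
    have hsub : {z | G (f z) ≤ s}ᶜ ⊆ ⋃ q : {q : ℚ // s < G q}, {z | (q : ℝ) ≤ f z} := fun z hz => by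
      obtain ⟨t, ht, htz⟩ := hleast (f z) (by simpa using hz)
      obtain ⟨q, hq, hq'⟩ := exists_rat_btwn htz
      exact Set.mem_iUnion.2 ⟨⟨q, ht.trans_le (hmono hq.le)⟩, hq'.le⟩
    have hdir : Directed (· ⊆ ·) fun q : {q : ℚ // s < G q} => {z | (q : ℝ) ≤ f z} := fun q r => by
      rcases le_total (q : ℚ) r with h | h
      · exact ⟨q, subset_rfl, fun z (hz : ((r : ℚ) : ℝ) ≤ f z) =>
          (Rat.cast_le.2 h).trans hz⟩
      · exact ⟨r, fun z (hz : ((q : ℚ) : ℝ) ≤ f z) => (Rat.cast_le.2 h).trans hz, subset_rfl⟩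
    refine (measure_mono hsub).trans ?_
    rw [hdir.measure_iUnion]
    exact iSup_le fun q => htail q.2

section Bounds

variable {W X Y : Type*} [MeasurableSpace W] [MeasurableSpace X] [MeasurableSpace Y] [Fintype Y]
  [Nontrivial Y] [MeasurableSingletonClass Y] {F : W → X → Y → ℝ} {c : ℝ} (hc : 0 < c)
  (hF : Measurable fun a : W × X × Y => F a.1 a.2.1 a.2.2) (hFc : ∀ w x y, |F w x y| ≤ c)
  (p₀ : Measure W) [IsProbabilityMeasure p₀]

theorem empiricalMarginError_nonneg {X Y : Type*} {N : ℕ} (D : Fin N → X × Y) (h : X → Y → ℝ)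
    (γ : ℝ) : 0 ≤ empiricalMarginError D h γ :=
  div_nonneg (Nat.cast_nonneg _) (Nat.cast_nonneg _)

include hF in
theorem measurable_margin_averagePredictor (p : Measure W) [IsProbabilityMeasure p] :
    Measurable fun z : X × Y => margin (averagePredictor p F) z.1 z.2 :=
  measurable_of_Iic fun t =>
    (measurableSet_margin_le (Ω := Unit) (Φ := fun _ => averagePredictor p F)
      ((measurable_averagePredictor hF p).comp measurable_snd) t).preimage
      (measurable_prodMk_left (x := ()))

include hc hF hFc in
/-- The margin bound for a single example. -/
theorem exists_measurableSet_margin_bound_single (Q : Measure (X × Y)) [IsProbabilityMeasure Q]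
    {δ : ℝ} (hδ₀ : 0 < δ) (hδ₁ : δ < 1) {C : ℝ} (hC1 : 1 ≤ C) (hCc : 512 * c ^ 2 ≤ C ^ 2) :
    ∃ E : Set (Fin 1 → X × Y), MeasurableSet E ∧
      1 - δ ≤ (Measure.pi fun _ : Fin 1 => Q).real E ∧
      ∀ D ∈ E, ∀ (p : Measure W) [IsProbabilityMeasure p], klDiv p p₀ ≠ ⊤ → ∀ γ : ℝ, 0 < γ →
        trueMarginError Q (averagePredictor p F) 0 ≤
          empiricalMarginError D (averagePredictor p F) γ +
            C * √(γ⁻¹ ^ 2 * (klDiv p p₀).toReal * Real.log (Fintype.card Y) + Real.log δ⁻¹) := by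
  set f : X × Y → ℝ := fun z => margin (averagePredictor p₀ F) z.1 z.2 with hf
  have hfm : Measurable f := measurable_margin_averagePredictor hF p₀
  -- The event involves only the prior predictor, so it serves all `p` and `γ` at once.
  set S : Set (X × Y) := {z | Q.real {z' | f z' < f z} ≤ 1 - δ} with hS
  have hSm : MeasurableSet S := measurableSet_le (measurable_measureReal_lt Q hfm) measurable_const
  refine ⟨(fun D => D 0) ⁻¹' S, measurable_pi_apply 0 hSm, ?_, fun D hD p _ hp γ hγ => ?_⟩
  · rw [measureReal_def, (measurePreserving_eval (fun _ : Fin 1 => Q) 0).measure_preimage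
      hSm.nullMeasurableSet]
    exact le_measureReal_quantile Q hfm (by linarith)
  set κ := (klDiv p p₀).toReal
  have hκ : 0 ≤ κ := ENNReal.toReal_nonneg
  set R := γ⁻¹ ^ 2 * κ * Real.log (Fintype.card Y) + Real.log δ⁻¹ with hR
  have hcard : (2 : ℝ) ≤ Fintype.card Y := by exact_mod_cast Fintype.one_lt_card
  have hL : 1 / 2 ≤ Real.log (Fintype.card Y) := by
    have := Real.log_le_log (by norm_num) hcard
    linarith [Real.log_two_gt_d9]
  have hU : 0 ≤ γ⁻¹ ^ 2 * κ * Real.log (Fintype.card Y) := by positivity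
  have hlog : 1 - δ ≤ Real.log δ⁻¹ := by
    rw [Real.log_inv]; linarith [Real.log_le_sub_one_of_pos hδ₀]
  have hR0 : 0 ≤ R := by linarith
  have hemp := empiricalMarginError_nonneg D (averagePredictor p F) γ
  have htrue : trueMarginError Q (averagePredictor p F) 0 ≤ 1 := measureReal_le_one
  by_cases hm : margin (averagePredictor p F) (D 0).1 (D 0).2 ≤ γ
  · have : empiricalMarginError D (averagePredictor p F) γ = 1 := by
      rw [empiricalMarginError, Finset.filter_true_of_mem fun i _ => by
        rwa [Subsingleton.elim i 0]]
      simp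
    have h2 : 0 ≤ C * √R := by positivity
    linarith
  rcases le_or_gt 1 (C ^ 2 * R) with hbig | hsmall
  · have : 1 ≤ C * √R := by
      rw [← Real.sqrt_sq (show 0 ≤ C by linarith), ← Real.sqrt_mul (sq_nonneg C)]
      exact Real.one_le_sqrt.2 hbig
    linarith
  have hκb : 512 * c ^ 2 * κ ≤ 2 * γ ^ 2 := by
    have h1 : C ^ 2 * (γ⁻¹ ^ 2 * κ * (1 / 2)) ≤ 1 := by
      refine le_trans ?_ hsmall.le
      refine mul_le_mul_of_nonneg_left ?_ (sq_nonneg C)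
      have : γ⁻¹ ^ 2 * κ * (1 / 2) ≤ γ⁻¹ ^ 2 * κ * Real.log (Fintype.card Y) := by gcongr
      linarith
    have h2 : C ^ 2 * (γ⁻¹ ^ 2 * κ * (1 / 2)) = C ^ 2 * κ / (2 * γ ^ 2) := by field_simp
    rw [h2, div_le_one (by positivity)] at h1
    exact (mul_le_mul_of_nonneg_right hCc hκ).trans h1
  have hclose (x : X) (y : Y) :
      |averagePredictor p F x y - averagePredictor p₀ F x y| ≤ γ / 8 := by
    -- This `t` gives `(512 c² κ + 2 γ²) / (32 γ)`, at most `γ / 8` by `hκb`.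
    have h1 := abs_integral_sub_integral_le hp (measurable_apply_apply hF x y)
      (fun w => hFc w x y) (t := 32 * c / γ) (by positivity)
    refine h1.trans ?_
    have h2 : c * (32 * c / γ * κ / 2 + 2 / (32 * c / γ)) =
        (512 * c ^ 2 * κ + 2 * γ ^ 2) / (32 * γ) := by
      field_simp
      ring
    rw [h2, div_le_iff₀ (by positivity)]
    linarith
  have hdiff (x : X) (y y' : Y) : |(averagePredictor p F x y - averagePredictor p F x y') -
      (averagePredictor p₀ F x y - averagePredictor p₀ F x y')| ≤ γ / 4 := by
    have h1 := abs_le.1 (hclose x y)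
    have h2 := abs_le.1 (hclose x y')
    exact abs_le.2 ⟨by linarith [h1.1, h2.2], by linarith [h1.2, h2.1]⟩
  have hm0 : γ / 2 < f (D 0) := (lt_margin_iff _ _ _ _).2 fun y' hne => by
    have h1 := (lt_margin_iff _ _ _ _).1 (not_le.1 hm) y' hne
    linarith [(abs_le.1 (hdiff (D 0).1 (D 0).2 y')).2]
  -- Errors of `h_p` have prior margin at most `γ/4`, while the observed example has prior margin
  -- above `γ/2`.
  have hsub : {z : X × Y | margin (averagePredictor p F) z.1 z.2 ≤ 0} ⊆
      {z | f z < f (D 0)} := fun z hz => by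
    obtain ⟨y', hne, hy'⟩ := (margin_le_iff _ _ _ _).1 hz
    have h1 : f z ≤ γ / 4 := (margin_le_iff _ _ _ _).2
      ⟨y', hne, by linarith [(abs_le.1 (hdiff z.1 z.2 y')).1]⟩
    exact h1.trans_lt (lt_trans (by linarith) hm0)
  have h1 : trueMarginError Q (averagePredictor p F) 0 ≤ 1 - δ := (measureReal_mono hsub).trans hD
  -- Indeed `(1 - δ)² ≤ 1 - δ ≤ log δ⁻¹ ≤ R`.
  have h2 : 1 - δ ≤ √R := by
    refine Real.le_sqrt_of_sq_le ?_
    nlinarith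
  have h3 : √R ≤ C * √R := le_mul_of_one_le_left (Real.sqrt_nonneg _) hC1
  linarith

end Bounds

/-! ### Dilated margin sets and the uniform event -/

section Bounds

variable {W X Y : Type*} [MeasurableSpace W] [MeasurableSpace X] [MeasurableSpace Y] [Fintype Y]
  [Nontrivial Y] [MeasurableSingletonClass Y] {F : W → X → Y → ℝ} {c : ℝ} (hc : 0 < c)
  (hF : Measurable fun a : W × X × Y => F a.1 a.2.1 a.2.2) (hFc : ∀ w x y, |F w x y| ≤ c)
  (p₀ : Measure W) [IsProbabilityMeasure p₀]

/-- The family of sampled margin sets whose shift is a multiple of the prior predictor. -/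
def dilatedMarginSet (F : W → X → Y → ℝ) (p₀ : Measure W) (T : ℕ) (θ : ℝ) (s : ℕ) :
    Set ((Fin T → W) × (X × Y)) :=
  sampledMarginSet F T (fun x y => s * averagePredictor p₀ F x y) θ

include hF in
theorem measurableSet_dilatedMarginSet (T : ℕ) (θ : ℝ) (s : ℕ) :
    MeasurableSet (dilatedMarginSet F p₀ T θ s) :=
  measurableSet_sampledMarginSet hF T ((measurable_averagePredictor hF p₀).const_mul _) θ

omit [MeasurableSpace X] [MeasurableSpace Y] [MeasurableSingletonClass Y] in
-- Each score difference is affine in the dilation index, so exceeding `θ` at two indices forces it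
-- in between.
theorem notMem_dilatedMarginSet_of_between {p₀ : Measure W} {T : ℕ} {θ : ℝ}
    (q : (Fin T → W) × (X × Y)) (r s t : ℕ) (hrs : r ≤ s) (hst : s ≤ t)
    (hr : q ∉ dilatedMarginSet F p₀ T θ r) (ht : q ∉ dilatedMarginSet F p₀ T θ t) :
    q ∉ dilatedMarginSet F p₀ T θ s := by
  have key (n : ℕ) : q ∉ dilatedMarginSet F p₀ T θ n ↔ ∀ y', y' ≠ q.2.2 →
      θ < sampledPredictor F (fun x y => n * averagePredictor p₀ F x y) q.1 q.2.1 q.2.2 -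
        sampledPredictor F (fun x y => n * averagePredictor p₀ F x y) q.1 q.2.1 y' :=
    not_le.trans (lt_margin_iff _ _ _ _)
  rw [key] at hr ht ⊢
  intro y' hne
  have h1 := hr y' hne
  have h2 := ht y' hne
  simp only [sampledPredictor] at h1 h2 ⊢
  have hrs' : (r : ℝ) ≤ s := by exact_mod_cast hrs
  have hst' : (s : ℝ) ≤ t := by exact_mod_cast hst
  rcases le_total 0 (averagePredictor p₀ F q.2.1 q.2.2 - averagePredictor p₀ F q.2.1 y') with h | h
  · nlinarith [mul_le_mul_of_nonneg_right hrs' h]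
  · nlinarith [mul_le_mul_of_nonpos_right hst' h]

include hc hF hFc in
/-- If the predictor `(s + 1) h_p` is uniformly close to `s h_{p₀} + h_{p'}`, then the deviation
of its margin errors is controlled by the exponential moments of the sampled predictors. -/
theorem trueMarginError_le_of_close (Q : Measure (X × Y)) [IsProbabilityMeasure Q] {N : ℕ}
    (hN : 0 < N) (D : Fin N → X × Y) {m T s : ℕ} (hm : 0 < m) {k b γ : ℝ} (hk : 0 < k) (hb : 0 < b)
    (hT : 32 * (m : ℝ) ^ 2 * Real.log (N * Fintype.card Y) ≤ T)
    (hD : ∫⁻ v, ⨆ s, ENNReal.ofReal (Real.exp (k *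
        (Q.real (Prod.mk v ⁻¹' dilatedMarginSet F p₀ T (c / m) s) -
          empiricalFreq D (Prod.mk v ⁻¹' dilatedMarginSet F p₀ T (c / m) s))))
        ∂(Measure.pi fun _ => p₀) ≤ ENNReal.ofReal b)
    (p p' : Measure W) [IsProbabilityMeasure p] [IsProbabilityMeasure p'] (hp' : klDiv p' p₀ ≠ ⊤)
    (hclose : ∀ x y, |(s + 1) * averagePredictor p F x y -
      (s * averagePredictor p₀ F x y + averagePredictor p' F x y)| ≤ c / (4 * m))
    (hγ : 2 * c / m ≤ (s + 1) * γ) :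
    trueMarginError Q (averagePredictor p F) 0 ≤
      empiricalMarginError D (averagePredictor p F) γ + 2 / N +
        (T * (klDiv p' p₀).toReal + Real.log b) / k := by
  have hm' : (0 : ℝ) < m := by exact_mod_cast hm
  have hN' : (1 : ℝ) ≤ N := by exact_mod_cast hN
  have hs : (0 : ℝ) ≤ s := Nat.cast_nonneg s
  have hcard : (2 : ℝ) ≤ Fintype.card Y := by exact_mod_cast Fintype.one_lt_card
  have hL : 0 < Real.log (N * Fintype.card Y) := Real.log_pos (by nlinarith)
  have hT' : 0 < T := by
    have : (0 : ℝ) < T := lt_of_lt_of_le (by positivity) hT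
    exact_mod_cast this
  have hclose' (x : X) (y y' : Y) :
      |(s + 1) * (averagePredictor p F x y - averagePredictor p F x y') -
        ((s * averagePredictor p₀ F x y + averagePredictor p' F x y) -
          (s * averagePredictor p₀ F x y' + averagePredictor p' F x y'))| ≤ c / (2 * m) := by
    have h1 := abs_le.1 (hclose x y)
    have h2 := abs_le.1 (hclose x y')
    have e : c / (2 * m) = c / (4 * m) + c / (4 * m) := by field_simp; norm_num
    rw [e]
    exact abs_le.2 ⟨by linarith [h1.1, h2.2], by linarith [h1.2, h2.1]⟩
  have e1 : c / m = c / (2 * m) + c / (2 * m) := by field_simp; norm_num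
  have e2 : 2 * c / m = c / m + c / m := by ring
  have hε : 0 ≤ c / (2 * m) := by positivity
  have hbm : Measurable fun z : X × Y => (s : ℝ) * averagePredictor p₀ F z.1 z.2 :=
    (measurable_averagePredictor hF p₀).const_mul _
  -- After scaling and approximation, score differences `≤ 0` become at most `c/(2m)` and those
  -- above `γ` at least `3c/(2m)`; the threshold `c/m` leaves `c/(2m)` on each side for sampling
  -- error.
  have h1 := trueMarginError_le_integral_sampled hc hF hFc p' Q hT' (θ := c / m) hε
    (b := fun x y => s * averagePredictor p₀ F x y) hbm (g := averagePredictor p F)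
    (measurable_averagePredictor hF p) fun x y y' h0 => by
      have := (abs_le.1 (hclose' x y y')).1
      have h3 : (s + 1) * (averagePredictor p F x y - averagePredictor p F x y') ≤ 0 :=
        mul_nonpos_of_nonneg_of_nonpos (by linarith) h0
      linarith
  have h2 := integral_sampled_le_empiricalMarginError hc hF hFc p' D hT' (θ := c / m) (γ := γ) hε
    (b := fun x y => s * averagePredictor p₀ F x y) hbm (g := averagePredictor p F) fun x y y' h0 => by
      have := (abs_le.1 (hclose' x y y')).2
      have h3 : (s + 1) * γ ≤ (s + 1) * (averagePredictor p F x y - averagePredictor p F x y') :=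
        mul_le_mul_of_nonneg_left h0.le (by linarith)
      linarith
  have hA := measurableSet_dilatedMarginSet hF p₀ T (c / m)
  have h3 := integral_deviation_le Q hp' hA hk hb D hD s
  have hi1 : Integrable (fun v => Q.real (Prod.mk v ⁻¹' dilatedMarginSet F p₀ T (c / m) s))
      (Measure.pi fun _ => p') :=
    Integrable.of_bound (measurable_measureReal_section Q (hA s)).aestronglyMeasurable 1
      (Filter.Eventually.of_forall fun v => by
        rw [Real.norm_eq_abs, abs_of_nonneg measureReal_nonneg]; exact measureReal_le_one)
  have hi2 : Integrable
      (fun v => empiricalFreq D (Prod.mk v ⁻¹' dilatedMarginSet F p₀ T (c / m) s))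
      (Measure.pi fun _ => p') :=
    Integrable.of_bound ((measurable_empiricalFreq_section (hA s)).comp
      measurable_prodMk_right).aestronglyMeasurable 1
      (Filter.Eventually.of_forall fun v => by
        rw [Real.norm_eq_abs, abs_of_nonneg (empiricalFreq_nonneg _ _)]
        exact empiricalFreq_le_one _ _)
  rw [integral_sub hi1 hi2] at h3
  -- The exponent is `T / (32 m²)`, which explains the lower bound on `T`; the factor `|Y|` still
  -- leaves a tail of `1/N`.
  have hη : Real.exp (-(T * (c / (2 * m)) ^ 2 / (8 * c ^ 2))) ≤ 1 / (N * Fintype.card Y) := by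
    rw [← Real.exp_log (show (0 : ℝ) < N * Fintype.card Y by positivity), one_div, ← Real.exp_neg]
    refine Real.exp_le_exp.2 (neg_le_neg ?_)
    have e : T * (c / (2 * m)) ^ 2 / (8 * c ^ 2) = T / (32 * m ^ 2) := by
      field_simp
      norm_num
    rw [e, le_div_iff₀ (by positivity)]
    linarith
  have hη1 : 1 / (N * Fintype.card Y : ℝ) ≤ 1 / N :=
    one_div_le_one_div_of_le (by linarith) (by nlinarith)
  have hη2 : Fintype.card Y * Real.exp (-(T * (c / (2 * m)) ^ 2 / (8 * c ^ 2))) ≤ 1 / N := by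
    refine (mul_le_mul_of_nonneg_left hη (by linarith)).trans (le_of_eq ?_)
    field_simp
  have e3 : (2 : ℝ) / N = 1 / N + 1 / N := by ring
  simp only [dilatedMarginSet] at h3
  linarith

omit [Fintype Y] [Nontrivial Y] [MeasurableSingletonClass Y] in
include hF hFc in
/-- Either the posterior itself (with scale `1`) or the dilation of its displacement from the prior
(with scale `s + 1`) provides a measure that approximates the scaled predictor. -/
theorem exists_posterior_close {p : Measure W} [IsProbabilityMeasure p] (hp : klDiv p p₀ ≠ ⊤)
    (s : ℕ) {ε : ℝ} (hε : 0 ≤ ε)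
    (h : s ≠ 0 → 28 * c * ((s : ℝ) + 1) ^ 2 * (klDiv p p₀).toReal ≤ ε) :
    ∃ p' : Measure W, IsProbabilityMeasure p' ∧ klDiv p' p₀ ≠ ⊤ ∧
      (klDiv p' p₀).toReal ≤ 9 * ((s : ℝ) + 1) ^ 2 * (klDiv p p₀).toReal ∧
      ∀ x y, |(s + 1) * averagePredictor p F x y -
        (s * averagePredictor p₀ F x y + averagePredictor p' F x y)| ≤ ε := by
  rcases eq_or_ne s 0 with rfl | hs
  · refine ⟨p, inferInstance, hp, ?_, fun x y => by simpa using hε⟩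
    have : 0 ≤ (klDiv p p₀).toReal := ENNReal.toReal_nonneg
    norm_num
    linarith
  · obtain ⟨p', h1, h2, h3, h4⟩ := exists_dilation hp (s := (s : ℝ) + 1)
      (by linarith [Nat.cast_nonneg (α := ℝ) s])
    refine ⟨p', h1, h2, h3, fun x y => ?_⟩
    have := h4 (fun w => F w x y) c (measurable_apply_apply hF x y) fun w => hFc w x y
    rw [add_sub_cancel_right] at this
    exact this.trans (h hs)

include hF in
/-- The sample event on which all exponential moments of the sampled predictors are controlled. -/
theorem exists_measurableSet_exp_moment_le (Q : Measure (X × Y)) [IsProbabilityMeasure Q] {N : ℕ}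
    (hN : 0 < N) {δ : ℝ} (hδ : 0 < δ) (T : ℕ → ℕ) :
    ∃ E : Set (Fin N → X × Y), MeasurableSet E ∧
      1 - δ ≤ (Measure.pi fun _ : Fin N => Q).real E ∧
      ∀ D ∈ E, ∀ m k : ℕ, 0 < m → m ≤ N → 0 < k → k ≤ N →
        ∫⁻ v, ⨆ s, ENNReal.ofReal (Real.exp (k *
          (Q.real (Prod.mk v ⁻¹' dilatedMarginSet F p₀ (T m) (c / m) s) -
            empiricalFreq D (Prod.mk v ⁻¹' dilatedMarginSet F p₀ (T m) (c / m) s))))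
          ∂(Measure.pi fun _ => p₀) ≤
        ENNReal.ofReal ((N * N : ℝ) *
          ((N + 1) ^ 2 * Real.exp (2 * k / N + (k : ℝ) ^ 2 / (8 * N))) / δ) := by
  have : Nonempty (Fin N) := ⟨⟨0, hN⟩⟩
  -- Only the `N²` pairs `(m, k)`, shifted to start at 1, enter the union bound; all `s` are covered
  -- by the inner supremum.
  obtain ⟨E, hE, hEδ, h⟩ := exists_measurableSet_forall_le (J := Fin N × Fin N)
    (Measure.pi fun _ : Fin N => Q)
    (I := fun j D => ∫⁻ v, ⨆ s, ENNReal.ofReal (Real.exp (((j.2 : ℕ) + 1 : ℕ) *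
          (Q.real (Prod.mk v ⁻¹' dilatedMarginSet F p₀ (T (j.1 + 1)) (c / ((j.1 : ℕ) + 1 : ℕ)) s) -
            empiricalFreq D
              (Prod.mk v ⁻¹' dilatedMarginSet F p₀ (T (j.1 + 1)) (c / ((j.1 : ℕ) + 1 : ℕ)) s))))
          ∂(Measure.pi fun _ => p₀))
    (fun j => (measurable_iSup_exp_deviation Q
      (measurableSet_dilatedMarginSet hF p₀ _ _) _).lintegral_prod_left')
    (b := fun j => (N + 1) ^ 2 * Real.exp (2 * ((j.2 : ℕ) + 1 : ℕ) / N +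
      (((j.2 : ℕ) + 1 : ℕ) : ℝ) ^ 2 / (8 * N)))
    (fun j => by positivity)
    (fun j => lintegral_lintegral_iSup_exp_deviation_le Q _ hN
      (measurableSet_dilatedMarginSet hF p₀ _ _) notMem_dilatedMarginSet_of_between
      (Nat.cast_nonneg _)) hδ
  refine ⟨E, hE, hEδ, fun D hD m k hm hmN hk hkN => ?_⟩
  obtain ⟨m, rfl⟩ : ∃ m', m = m' + 1 := ⟨m - 1, by omega⟩
  obtain ⟨k, rfl⟩ : ∃ k', k = k' + 1 := ⟨k - 1, by omega⟩
  have := h D hD (⟨m, by omega⟩, ⟨k, by omega⟩)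
  simpa only [Fintype.card_prod, Fintype.card_fin, Nat.cast_mul] using this

end Bounds

/-! ### Choice of parameters and the case of at least two examples -/

section Bounds

variable {W X Y : Type*} [MeasurableSpace W] [MeasurableSpace X] [MeasurableSpace Y] [Fintype Y]
  [Nontrivial Y] [MeasurableSingletonClass Y] {F : W → X → Y → ℝ} {c : ℝ} (hc : 0 < c)
  (hF : Measurable fun a : W × X × Y => F a.1 a.2.1 a.2.2) (hFc : ∀ w x y, |F w x y| ≤ c)
  (p₀ : Measure W) [IsProbabilityMeasure p₀]

omit [MeasurableSpace X] [MeasurableSpace Y] [MeasurableSingletonClass Y] in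
include hFc in
theorem margin_averagePredictor_le (p : Measure W) [IsProbabilityMeasure p] (x : X) (y : Y) :
    margin (averagePredictor p F) x y ≤ 2 * c := by
  obtain ⟨y', hne⟩ := exists_ne y
  have hb (y : Y) : |averagePredictor p F x y| ≤ c := by
    simpa [averagePredictor] using norm_integral_le_of_norm_le_const (μ := p) (f := fun w => F w x y)
      (Filter.Eventually.of_forall fun w => hFc w x y)
  refine (margin_le_iff _ _ _ _).2 ⟨y', hne, ?_⟩
  linarith [(abs_le.1 (hb y)).2, (abs_le.1 (hb y')).1]

/-- Choosing the integer parameter of the exponential moment optimally. -/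
theorem exists_nat_div_add_le {N : ℕ} (hN : 0 < N) {A : ℝ} (hA1 : 1 ≤ A) (hAN : A ≤ N) :
    ∃ k : ℕ, 0 < k ∧ k ≤ N ∧ A / k + k / (8 * N) ≤ 5 / 4 * √(A / N) := by
  have hN' : (0 : ℝ) < N := by exact_mod_cast hN
  have hN1 : (1 : ℝ) ≤ N := by exact_mod_cast hN
  -- Rounding up `√(N A)` rather than the exact minimiser `√(8 N A)` loses only a constant and keeps
  -- `k ≤ N`.
  set r := √(N * A) with hr
  have hr1 : 1 ≤ r := Real.one_le_sqrt.2 (by nlinarith)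
  have hrr : r * r = N * A := Real.mul_self_sqrt (by positivity)
  have hrN : r ≤ N := by
    rw [hr]
    exact Real.sqrt_le_iff.2 ⟨hN'.le, by nlinarith⟩
  have hrd : √(A / N) = r / N := by
    rw [hr, eq_div_iff hN'.ne', ← Real.sqrt_sq hN'.le, ← Real.sqrt_mul (by positivity),
      Real.sqrt_sq hN'.le]
    congr 1
    field_simp
  have hk0 : r ≤ ⌈r⌉₊ := Nat.le_ceil r
  have hk1 : (⌈r⌉₊ : ℝ) < r + 1 := Nat.ceil_lt_add_one (by linarith)
  refine ⟨⌈r⌉₊, Nat.ceil_pos.2 (by linarith), Nat.ceil_le.2 hrN, ?_⟩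
  rw [hrd]
  have h1 : A / ⌈r⌉₊ ≤ r / N := by
    rw [div_le_div_iff₀ (by linarith) hN']
    nlinarith
  have h2 : (⌈r⌉₊ : ℝ) / (8 * N) ≤ 1 / 4 * (r / N) := by
    rw [div_le_iff₀ (by positivity)]
    have : 1 / 4 * (r / N) * (8 * N) = 2 * r := by field_simp; norm_num
    linarith
  linarith

/-- The scale `s + 1` and the inverse resolution `m` attached to a margin `γ`. -/
theorem exists_scale_resolution (hc : 0 < c) {γ : ℝ} (hγ : 0 < γ) (hγc : γ ≤ 2 * c) {N : ℕ}
    (hN : 2 ≤ N) :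
    ∃ s m : ℕ, 0 < m ∧ m ≤ N ∧ 2 * c / m ≤ (s + 1) * γ ∧ m * ((s + 1) * γ) ≤ 4 * c ∧
      (s ≠ 0 → (s + 1) * γ * N ≤ 4 * c) := by
  have hN' : (2 : ℝ) ≤ N := by exact_mod_cast hN
  -- The least multiple bringing the margin up to `2c/N`, so that the resolution `⌈2c / ((s + 1)
  -- γ)⌉` is at most `N`; `s = 0` when `γ ≥ 2c/N`.
  set s' := ⌈2 * c / (N * γ)⌉₊ with hs'
  have hpos : 0 < s' := Nat.ceil_pos.2 (by positivity)
  obtain ⟨s, hs⟩ : ∃ s, s' = s + 1 := ⟨s' - 1, by omega⟩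
  have hsc : (s' : ℝ) = s + 1 := by rw [hs]; push_cast; ring
  have hlow : 2 * c ≤ (s + 1) * γ * N := by
    have := Nat.le_ceil (2 * c / (N * γ))
    rw [← hs', hsc, div_le_iff₀ (by positivity)] at this
    linarith
  have hup : (s + 1) * γ * N < 2 * c + N * γ := by
    have := Nat.ceil_lt_add_one (show 0 ≤ 2 * c / (N * γ) by positivity)
    rw [← hs', hsc, ← sub_lt_iff_lt_add, lt_div_iff₀ (by positivity)] at this
    linarith
  have hs4 : s ≠ 0 → (s + 1) * γ * N ≤ 4 * c := fun h0 => by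
    have h1 : (1 : ℝ) ≤ s := by exact_mod_cast Nat.one_le_iff_ne_zero.2 h0
    have h2 : N * γ ≤ s * (N * γ) := le_mul_of_one_le_left (by positivity) h1
    linarith
  have hγ'c : (s + 1) * γ ≤ 2 * c := by
    rcases eq_or_ne s 0 with rfl | h0
    · simpa using hγc
    · have h1 := hs4 h0
      have h2 : (s + 1) * γ * 2 ≤ (s + 1) * γ * N := by gcongr
      linarith
  set g := (s + 1) * γ with hg
  have hg0 : 0 < g := by positivity
  have hm1 : 1 ≤ 2 * c / g := (one_le_div hg0).2 hγ'c
  have hmle := Nat.le_ceil (2 * c / g)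
  have hmlt := Nat.ceil_lt_add_one (show 0 ≤ 2 * c / g by positivity)
  have hm0 : 0 < ⌈2 * c / g⌉₊ := Nat.ceil_pos.2 (by linarith)
  have hm0' : (0 : ℝ) < ⌈2 * c / g⌉₊ := by exact_mod_cast hm0
  refine ⟨s, ⌈2 * c / g⌉₊, hm0, Nat.ceil_le.2 ?_, ?_, ?_, hs4⟩
  · rw [div_le_iff₀ hg0]; linarith
  · rw [div_le_iff₀ hm0', ← hg]
    rw [div_le_iff₀ hg0] at hmle
    linarith
  · rw [← hg]
    have h1 : (⌈2 * c / g⌉₊ : ℝ) ≤ 2 * (2 * c / g) := by linarith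
    have h2 : 2 * (2 * c / g) * g = 4 * c := by field_simp; norm_num
    nlinarith

include hc hF hFc in
/-- The margin bound for samples with at least two examples. -/
theorem exists_measurableSet_margin_bound_of_two_le (Q : Measure (X × Y)) [IsProbabilityMeasure Q]
    {N : ℕ} (hN : 2 ≤ N) {δ : ℝ} (hδ₀ : 0 < δ) (hδ₁ : δ < 1) :
    ∃ E : Set (Fin N → X × Y), MeasurableSet E ∧
      1 - δ ≤ (Measure.pi fun _ : Fin N => Q).real E ∧
      ∀ D ∈ E, ∀ (p : Measure W) [IsProbabilityMeasure p], klDiv p p₀ ≠ ⊤ → ∀ γ : ℝ, 0 < γ →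
        trueMarginError Q (averagePredictor p F) 0 ≤
          empiricalMarginError D (averagePredictor p F) γ + 2000 * (c + 1) *
            √((γ⁻¹ ^ 2 * (klDiv p p₀).toReal * Real.log (N * Fintype.card Y) + Real.log N +
              Real.log δ⁻¹) / N) := by
  -- Here `1792 = 28 · 4 · 4²` comes from the dilation error, `9216 = 64 · 9 · 4²` from `T · KL(p' ‖
  -- p₀)`, and 6 from the logarithmic cost of the union bound and brackets.
  have hc1792 : 1792 * c ^ 2 ≤ (2000 * (c + 1)) ^ 2 := by nlinarith
  have hc9216 : 9216 * c ^ 2 ≤ (100 * (c + 1)) ^ 2 := by nlinarith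
  have hc6 : 6 ≤ (100 * (c + 1)) ^ 2 := by nlinarith
  have hc2000 : (100 * (c + 1)) ^ 2 ≤ (2000 * (c + 1)) ^ 2 := by nlinarith
  set L := Real.log (N * Fintype.card Y) with hLdef
  obtain ⟨E, hE, hEδ, hmom⟩ := exists_measurableSet_exp_moment_le (c := c) hF p₀ Q
    (by omega : 0 < N) hδ₀ fun m => ⌈32 * (m : ℝ) ^ 2 * L⌉₊
  refine ⟨E, hE, hEδ, fun D hD p _ hp γ hγ => ?_⟩
  have hN' : (2 : ℝ) ≤ N := by exact_mod_cast hN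
  have hN0 : (0 : ℝ) < N := by linarith
  have hN1 : (N : ℝ) + 1 ≤ N ^ 2 := by nlinarith
  have hcard : (2 : ℝ) ≤ Fintype.card Y := by exact_mod_cast Fintype.one_lt_card
  have hlogN : 1 / 2 ≤ Real.log N := by
    have := Real.log_le_log (by norm_num) hN'
    linarith [Real.log_two_gt_d9]
  have hL : 1 ≤ L := by
    rw [hLdef, Real.log_mul (by positivity) (by positivity)]
    have h1 := Real.log_le_log (by norm_num) hN'
    have h2 := Real.log_le_log (by norm_num) hcard
    linarith [Real.log_two_gt_d9]
  have hlogδ : 0 < Real.log δ⁻¹ := Real.log_pos ((one_lt_inv₀ hδ₀).2 hδ₁)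
  set κ := (klDiv p p₀).toReal with hκdef
  have hκ : 0 ≤ κ := ENNReal.toReal_nonneg
  set U := γ⁻¹ ^ 2 * κ * L with hU
  have hU0 : 0 ≤ U := by positivity
  set R := U + Real.log N + Real.log δ⁻¹ with hR
  set C := 2000 * (c + 1) with hC
  have hC0 : 0 < C := by positivity
  have hemp := empiricalMarginError_nonneg D (averagePredictor p F) γ
  have htrue : trueMarginError Q (averagePredictor p F) 0 ≤ 1 := measureReal_le_one
  have hRHS : 0 ≤ C * √(R / N) := by positivity
  rcases le_or_gt (N : ℝ) (C ^ 2 * R) with hbig | hsmall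
  · have : 1 ≤ C * √(R / N) := by
      rw [← Real.sqrt_sq hC0.le, ← Real.sqrt_mul (sq_nonneg C), ← mul_div_assoc]
      exact Real.one_le_sqrt.2 ((one_le_div hN0).2 hbig)
    linarith
  rcases le_or_gt (2 * c) γ with hγc | hγc
  · have : empiricalMarginError D (averagePredictor p F) γ = 1 := by
      rw [empiricalMarginError, Finset.filter_true_of_mem fun i _ =>
        (margin_averagePredictor_le hFc p _ _).trans hγc]
      simp [hN0.ne']
    linarith
  obtain ⟨s, m, hm0, hmN, hmγ, hmγ', hsN⟩ := exists_scale_resolution hc hγ hγc.le hN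
  have hm' : (1 : ℝ) ≤ m := by exact_mod_cast hm0
  set T := ⌈32 * (m : ℝ) ^ 2 * L⌉₊ with hT
  -- Nontriviality of the bound gives `C² κ ≤ N γ²`; with `m (s + 1) γ ≤ 4c` and `(s + 1) γ N ≤ 4c`
  -- the dilation error fits within the resolution.
  have hsmallκ : s ≠ 0 → 28 * c * ((s : ℝ) + 1) ^ 2 * κ ≤ c / (4 * m) := fun hs => by
    have h1 : C ^ 2 * κ ≤ N * γ ^ 2 := by
      have h2 : γ⁻¹ ^ 2 * κ ≤ R := by
        have : γ⁻¹ ^ 2 * κ ≤ U := le_mul_of_one_le_right (by positivity) hL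
        linarith
      have h3 : C ^ 2 * (γ⁻¹ ^ 2 * κ) ≤ N :=
        (mul_le_mul_of_nonneg_left h2 (sq_nonneg C)).trans hsmall.le
      have h4 : C ^ 2 * (γ⁻¹ ^ 2 * κ) = C ^ 2 * κ / γ ^ 2 := by field_simp
      rwa [h4, div_le_iff₀ (by positivity)] at h3
    have h5 := hsN hs
    rw [le_div_iff₀ (by positivity)]
    have h6 : 28 * c * ((s : ℝ) + 1) ^ 2 * κ * (4 * m) * γ ^ 2 * (C ^ 2) ≤
        c * γ ^ 2 * C ^ 2 := by
      calc 28 * c * ((s : ℝ) + 1) ^ 2 * κ * (4 * m) * γ ^ 2 * (C ^ 2)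
          = 112 * c * (m * ((s + 1) * γ)) * ((s + 1) * γ) * (C ^ 2 * κ) := by ring
        _ ≤ 112 * c * (4 * c) * ((s + 1) * γ) * (N * γ ^ 2) := by gcongr
        _ = 448 * c ^ 2 * ((s + 1) * γ * N) * γ ^ 2 := by ring
        _ ≤ 448 * c ^ 2 * (4 * c) * γ ^ 2 := by gcongr
        _ = c * γ ^ 2 * (1792 * c ^ 2) := by ring
        _ ≤ c * γ ^ 2 * C ^ 2 := mul_le_mul_of_nonneg_left hc1792 (by positivity)
    have h7 : 28 * c * ((s : ℝ) + 1) ^ 2 * κ * (4 * m) * (γ ^ 2 * C ^ 2) ≤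
        c * (γ ^ 2 * C ^ 2) := by linarith
    exact le_of_mul_le_mul_right h7 (by positivity)
  obtain ⟨p', hp'p, hp', hp'κ, hclose⟩ := exists_posterior_close hF hFc p₀ hp s
    (show 0 ≤ c / (4 * m) by positivity) hsmallκ
  have hTle : (T : ℝ) ≤ 64 * m ^ 2 * L := by
    have h1 := Nat.ceil_lt_add_one (show 0 ≤ 32 * (m : ℝ) ^ 2 * L by positivity)
    have h2 : 1 ≤ (m : ℝ) ^ 2 * L := by
      have : 1 ≤ (m : ℝ) ^ 2 := one_le_pow₀ hm'
      nlinarith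
    linarith
  -- The scale cancels: `m²` from `T` and `(s + 1)²` from the dilation combine with `γ²` into `(m (s
  -- + 1) γ)² ≤ (4c)²`.
  have hTκ : T * (klDiv p' p₀).toReal ≤ 9216 * c ^ 2 * U := by
    have h1 : T * (klDiv p' p₀).toReal ≤ 64 * m ^ 2 * L * (9 * ((s : ℝ) + 1) ^ 2 * κ) :=
      mul_le_mul hTle hp'κ ENNReal.toReal_nonneg (by positivity)
    have h2 : 64 * m ^ 2 * L * (9 * ((s : ℝ) + 1) ^ 2 * κ) =
        576 * (m * ((s + 1) * γ)) ^ 2 * U := by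
      rw [hU]; field_simp; ring
    have h3 : 576 * (m * ((s + 1) * γ)) ^ 2 * U ≤ 576 * (4 * c) ^ 2 * U := by gcongr
    linarith
  -- The `N²` pairs cost `2 log N` and the `(N + 1)²` brackets at most `4 log N`, since `N + 1 ≤
  -- N²`.
  set A := 9216 * c ^ 2 * U + 6 * Real.log N + Real.log δ⁻¹ with hA
  have hA1 : 1 ≤ A := by
    have : 0 ≤ 9216 * c ^ 2 * U := by positivity
    linarith
  have hAR : A ≤ (100 * (c + 1)) ^ 2 * R := by
    have h1 : 9216 * c ^ 2 * U ≤ (100 * (c + 1)) ^ 2 * U :=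
      mul_le_mul_of_nonneg_right hc9216 hU0
    have h2 : 6 * Real.log N ≤ (100 * (c + 1)) ^ 2 * Real.log N :=
      mul_le_mul_of_nonneg_right hc6 (by linarith)
    have h3 : 1 * Real.log δ⁻¹ ≤ (100 * (c + 1)) ^ 2 * Real.log δ⁻¹ :=
      mul_le_mul_of_nonneg_right (by linarith) hlogδ.le
    rw [hR]
    linarith
  have hR0 : 1 / 2 ≤ R := by linarith
  have hAN : A ≤ N := by
    have : (100 * (c + 1)) ^ 2 * R ≤ C ^ 2 * R :=
      mul_le_mul_of_nonneg_right hc2000 (by linarith)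
    linarith
  obtain ⟨k, hk0, hkN, hk⟩ := exists_nat_div_add_le (by omega : 0 < N) hA1 hAN
  have hk' : (0 : ℝ) < k := by exact_mod_cast hk0
  have hmain := trueMarginError_le_of_close hc hF hFc p₀ Q (by omega : 0 < N) D hm0 hk'
    (by positivity) (Nat.le_ceil (32 * (m : ℝ) ^ 2 * L)) (hmom D hD m k hm0 hmN hk0 hkN) p p' hp'
    hclose hmγ
  have hlogb : Real.log ((N * N : ℝ) *
          ((N + 1) ^ 2 * Real.exp (2 * k / N + (k : ℝ) ^ 2 / (8 * N))) / δ) ≤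
      6 * Real.log N + Real.log δ⁻¹ + (2 * k / N + (k : ℝ) ^ 2 / (8 * N)) := by
    rw [div_eq_mul_inv, Real.log_mul (by positivity) (by positivity),
      Real.log_mul (by positivity) (by positivity), Real.log_mul (by positivity) (by positivity),
      Real.log_mul (by positivity) (by positivity), Real.log_exp, Real.log_pow]
    have h1 : Real.log ((N : ℝ) + 1) ≤ 2 * Real.log N := by
      rw [← Nat.cast_two (R := ℝ), ← Real.log_pow]
      exact Real.log_le_log (by positivity) hN1
    push_cast
    linarith
  have hfrac : (T * (klDiv p' p₀).toReal + Real.log ((N * N : ℝ) *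
          ((N + 1) ^ 2 * Real.exp (2 * k / N + (k : ℝ) ^ 2 / (8 * N))) / δ)) / k ≤
      A / k + k / (8 * N) + 2 / N := by
    have e : A / k + k / (8 * N) + 2 / N = (A + (2 * k / N + (k : ℝ) ^ 2 / (8 * N))) / k := by
      field_simp
      ring
    rw [e]
    refine div_le_div_of_nonneg_right ?_ hk'.le
    linarith
  have hsqA : √(A / N) ≤ 100 * (c + 1) * √(R / N) := by
    rw [← Real.sqrt_sq (show 0 ≤ 100 * (c + 1) by positivity), ← Real.sqrt_mul (sq_nonneg _),
      ← mul_div_assoc]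
    exact Real.sqrt_le_sqrt (div_le_div_of_nonneg_right hAR hN0.le)
  have hinv : 1 / (N : ℝ) ≤ √(R / N) := by
    refine Real.le_sqrt_of_sq_le ?_
    rw [div_pow, one_pow, pow_two, ← div_div]
    refine div_le_div_of_nonneg_right ?_ hN0.le
    exact (one_div_le_one_div_of_le two_pos hN').trans hR0
  have e4 : (2 : ℝ) / N = 2 * (1 / N) := by ring
  -- Sampling and bracketing errors contribute `2/N` each; `125 = 100 · 5/4` comes from the choice
  -- of `k`.
  have hfin : 4 * √(R / N) + 125 * (c + 1) * √(R / N) ≤ C * √(R / N) := by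
    rw [← add_mul]
    refine mul_le_mul_of_nonneg_right ?_ (Real.sqrt_nonneg _)
    rw [hC]; linarith
  linarith

end Bounds

end MaxEnDNet

/-- PAC-Bayes margin bound for the averaging predictor: the constant hidden in the `O` depends only
on the bound `c` of the discriminant functions. A posterior with infinite Kullback-Leibler
divergence has an infinite right-hand side, so only posteriors with finite divergence appear. -/
theorem theorem8 (c : ℝ) (hc : 0 < c) :
    ∃ C : ℝ, 0 < C ∧
      ∀ (W : Type*) [MeasurableSpace W] (X : Type*) [MeasurableSpace X]
        (Y : Type*) [Fintype Y] [Nontrivial Y] [MeasurableSpace Y] [MeasurableSingletonClass Y]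
        (F : W → X → Y → ℝ)
        (_hF : Measurable fun a : W × X × Y => F a.1 a.2.1 a.2.2)
        (_hFc : ∀ w x y, |F w x y| ≤ c)
        (p₀ : Measure W) [IsProbabilityMeasure p₀]
        (Q : Measure (X × Y)) [IsProbabilityMeasure Q]
        (N : ℕ) (_hN : 1 ≤ N) (δ : ℝ) (_hδ₀ : 0 < δ) (_hδ₁ : δ < 1),
        ∃ E : Set (Fin N → X × Y), MeasurableSet E ∧
          1 - δ ≤ (Measure.pi fun _ : Fin N => Q).real E ∧
          ∀ D ∈ E, ∀ (p : Measure W) [IsProbabilityMeasure p],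
            InformationTheory.klDiv p p₀ ≠ ⊤ →
            ∀ γ : ℝ, 0 < γ →
              MaxEnDNet.trueMarginError Q (MaxEnDNet.averagePredictor p F) 0 ≤
                MaxEnDNet.empiricalMarginError D (MaxEnDNet.averagePredictor p F) γ +
                  C * Real.sqrt
                    ((γ⁻¹ ^ 2 * (InformationTheory.klDiv p p₀).toReal *
                          Real.log ((N : ℝ) * (Fintype.card Y : ℝ)) +
                        Real.log (N : ℝ) + Real.log δ⁻¹) / (N : ℝ)) := by
  refine ⟨2000 * (c + 1), by positivity, ?_⟩
  intro W _ X _ Y _ _ _ _ F hF hFc p₀ _ Q _ N hN δ hδ₀ hδ₁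
  -- At `N = 1` the term `log N` is 0 and cannot absorb additive constants, so this case needs its
  -- own argument.
  rcases hN.eq_or_lt with rfl | hN2
  · obtain ⟨E, hE, hEδ, h⟩ := MaxEnDNet.exists_measurableSet_margin_bound_single hc hF hFc p₀ Q
      hδ₀ hδ₁ (C := 2000 * (c + 1)) (by linarith) (by nlinarith)
    refine ⟨E, hE, hEδ, fun D hD p _ hp γ hγ => ?_⟩
    simpa using h D hD p hp γ hγ
  · exact MaxEnDNet.exists_measurableSet_margin_bound_of_two_le hc hF hFc p₀ Q hN2 hδ₀ hδ₁
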